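/- Let $H$ be an infinite-dimensional separable complex Hilbert space, $\mathcal B(H)$ the algebra of bounded operators on $H$, $\mathcal K(H)$ the closed two-sided ideal of compact operators, and $\mathcal B(H)/\mathcal K(H)$ the Calkin algebra with the quotient norm. Let $G=\mathcal B(H)^\times$ be the group of invertible operators, $K=\mathcal B(H)^\times\cap(\mathbb 1+\mathcal K(H))$ (a normal subgroup of $G$), and let $$\iota: G/K\to(\mathcal B(H)/\mathcal K(H))^\times,\qquad \iota(aK)=a+\mathcal K(H).$$ For a Fredholm operator $T$, its index is $\dim\ker T-\dim(H/\operatorname{ran}T)\in\mathbb Z$. Then: 1. $G=\mathcal B(H)^\times$ is connected in the norm topology. 2. The connected components of the set $\mathcal F(H)\subset\mathcal B(H)$ of Fredholm operators are exactly the sets $\{T\in\mathcal F(H):\operatorname{index}T=k\}$, $k\in\mathbb Z$, and each of these sets is non-empty. 3. For $T\in\mathcal B(H)$, the class $T+\mathcal K(H)$ belongs to the identity component of the group $(\mathcal B(H)/\mathcal K(H))^\times$ if and only if $T$ is a Fredholm operator of index $0$. 4. The topological group $G/K$ carries the structure of a real Banach--Lie group, modelled on $\mathcal B(H)/\mathcal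 K(H)$, for which the quotient map $G\to G/K$ is a submersion (a smooth map whose differential is surjective at every point); and for every such structure, $\iota$ is an isomorphism of Banach--Lie groups (a group isomorphism that is smooth with smooth inverse) from $G/K$ onto the identity component of $(\mathcal B(H)/\mathcal K(H))^\times$. 5. $\iota$ is not surjective onto $(\mathcal B(H)/\mathcal K(H))^\times$. -/

import Mathlib

open scoped Manifold ContDiff

noncomputable section

namespace CalkinRemark

variable (H : Type*) [NormedAddCommGroup H] [InnerProductSpace ℂ H] [CompleteSpace H]

/-- The two-sided ideal `𝒦(H)` of compact operators in `𝓑(H)`. -/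
def compactIdeal : Ideal (H →L[ℂ] H) where
  carrier := {T | IsCompactOperator T}
  add_mem' hS hT := hS.add hT
  zero_mem' := isCompactOperator_zero
  smul_mem' S _ hT := hT.clm_comp S

instance : (compactIdeal H).IsTwoSided where
  mul_mem_of_left S hT := IsCompactOperator.comp_clm hT S

instance : IsClosed (compactIdeal H : Set (H →L[ℂ] H)) :=
  isClosed_setOfPred_isCompactOperator

/-- The Calkin algebra `𝓑(H)/𝒦(H)`. -/
def Calkin : Type _ := (H →L[ℂ] H) ⧸ compactIdeal H

/-- The quotient norm. -/
instance : NormedAddCommGroup (Calkin H) :=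
  inferInstanceAs (NormedAddCommGroup ((H →L[ℂ] H) ⧸ compactIdeal H))

instance : Ring (Calkin H) :=
  inferInstanceAs (Ring ((H →L[ℂ] H) ⧸ compactIdeal H))

instance : CompleteSpace (Calkin H) :=
  inferInstanceAs (CompleteSpace ((H →L[ℂ] H) ⧸ compactIdeal H))

/-- The quotient map `Q : 𝓑(H) → 𝓑(H)/𝒦(H)`. -/
def Q : (H →L[ℂ] H) →+* Calkin H := Ideal.Quotient.mk (compactIdeal H)

theorem Q_norm_le (T : H →L[ℂ] H) : ‖Q H T‖ ≤ ‖T‖ :=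
  Submodule.Quotient.norm_mk_le (compactIdeal H) T

theorem exists_Q_norm_lt (x : Calkin H) {ε : ℝ} (hε : 0 < ε) :
    ∃ T, Q H T = x ∧ ‖T‖ < ‖x‖ + ε :=
  Submodule.Quotient.norm_mk_lt (S := compactIdeal H) x hε

theorem Q_eq_iff (S T : H →L[ℂ] H) : Q H S = Q H T ↔ IsCompactOperator (S - T) :=
  Ideal.Quotient.eq

instance : NormedRing (Calkin H) where
  __ := (inferInstance : NormedAddCommGroup (Calkin H))
  __ := (inferInstance : Ring (Calkin H))
  norm_mul_le x y := by
    have key : ∀ ε : ℝ, 0 < ε → ‖x * y‖ ≤ (‖x‖ + ε) * (‖y‖ + ε) := by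
      intro ε hε
      obtain ⟨S, rfl, hS⟩ := exists_Q_norm_lt H x hε
      obtain ⟨T, rfl, hT⟩ := exists_Q_norm_lt H y hε
      rw [← map_mul]
      refine (Q_norm_le H _).trans ((norm_mul_le S T).trans ?_)
      gcongr
    have hlim : Filter.Tendsto (fun ε : ℝ => (‖x‖ + ε) * (‖y‖ + ε))
        (nhdsWithin 0 (Set.Ioi 0)) (nhds ((‖x‖ + 0) * (‖y‖ + 0))) :=
      Filter.Tendsto.mono_left
        (Continuous.tendsto (by fun_prop) 0) nhdsWithin_le_nhds
    rw [add_zero, add_zero] at hlim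
    exact ge_of_tendsto hlim (Filter.eventually_of_mem self_mem_nhdsWithin fun ε hε => key ε hε)

instance : Algebra ℂ (Calkin H) :=
  inferInstanceAs (Algebra ℂ ((H →L[ℂ] H) ⧸ compactIdeal H))

instance : NormedAlgebra ℂ (Calkin H) where
  norm_smul_le c x :=
    norm_smul_le (β := (H →L[ℂ] H) ⧸ compactIdeal H) c x

/-- The Banach-Lie group `G = 𝓑(H)ˣ`. -/
abbrev G : Type _ := (H →L[ℂ] H)ˣ

/-- The subgroup `K = 𝓑(H)ˣ ∩ (1 + 𝒦(H))` of `G`. -/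
def K : Subgroup (G H) where
  carrier := {g | ((g : H →L[ℂ] H) - (1 : H →L[ℂ] H)) ∈ compactIdeal H}
  one_mem' := by
    simp
  mul_mem' {a b} ha hb := by
    have h := (Q_eq_iff H _ _).2 ha
    have h' := (Q_eq_iff H _ _).2 hb
    refine (Q_eq_iff H _ _).1 ?_
    rw [Units.val_mul, map_mul, h, h', ← map_mul, mul_one]
  inv_mem' {a} ha := by
    have h := (Q_eq_iff H _ _).2 ha
    refine (Q_eq_iff H _ _).1 ?_
    have h1 : Q H (a : H →L[ℂ] H) * Q H ((a⁻¹ : G H) : H →L[ℂ] H) = 1 := by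
      rw [← map_mul, Units.mul_inv, map_one]
    rwa [h, map_one, one_mul, ← map_one (Q H)] at h1

theorem mem_K_iff (g : G H) : g ∈ K H ↔ Q H (g : H →L[ℂ] H) = 1 := by
  rw [← map_one (Q H), Q_eq_iff]
  exact Iff.rfl

instance : (K H).Normal where
  conj_mem n hn g := by
    rw [mem_K_iff] at hn ⊢
    rw [Units.val_mul, Units.val_mul, map_mul, map_mul, hn, mul_one, ← map_mul,
      Units.mul_inv, map_one]

/-- The homomorphism `ι : G/K → (𝓑(H)/𝒦(H))ˣ`, `a K ↦ a + 𝒦(H)`. -/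
def iota : G H ⧸ K H →* (Calkin H)ˣ :=
  QuotientGroup.lift (K H) (Units.map (Q H : (H →L[ℂ] H) →* Calkin H)) fun g hg =>
    Units.ext ((mem_K_iff H g).1 hg)

theorem coe_iota_mk (a : G H) :
    (iota H (QuotientGroup.mk a) : Calkin H) = Q H (a : H →L[ℂ] H) := rfl

/-- `G/K`, with the quotient topology and with the given atlas modelled on `𝓑(H)/𝒦(H)`, is a real
Banach-Lie group for which the quotient map `π : G → G/K` is a submersion, that is, a smooth map
whose differential is surjective at every point. -/
structure IsQuotientBanachLieGroup [ChartedSpace (Calkin H) (G H ⧸ K H)] : Prop where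
  lieGroup : LieGroup 𝓘(ℝ, Calkin H) ∞ (G H ⧸ K H)
  contMDiff_mk : ContMDiff 𝓘(ℝ, H →L[ℂ] H) 𝓘(ℝ, Calkin H) ∞
    (QuotientGroup.mk : G H → G H ⧸ K H)
  surjective_mfderiv_mk : ∀ g : G H, Function.Surjective
    (mfderiv 𝓘(ℝ, H →L[ℂ] H) 𝓘(ℝ, Calkin H) (QuotientGroup.mk : G H → G H ⧸ K H) g)

/-- The identity component of the group of invertible elements of the Calkin algebra. -/
def identityComponent : Subgroup (Calkin H)ˣ :=
  Subgroup.connectedComponentOfOne (Calkin H)ˣ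

theorem isOpen_identityComponent : IsOpen (identityComponent H : Set (Calkin H)ˣ) := by
  have : LocallyConnectedSpace (Calkin H) :=
    letI := NormedSpace.complexToReal (E := Calkin H)
    inferInstance
  have : LocallyConnectedSpace (Calkin H)ˣ :=
    ChartedSpace.locallyConnectedSpace (Calkin H) _
  exact isOpen_connectedComponent

theorem isOpenEmbedding_coe :
    Topology.IsOpenEmbedding (fun u : identityComponent H => ((u : (Calkin H)ˣ) : Calkin H)) :=
  Units.isOpenEmbedding_val.comp (isOpen_identityComponent H).isOpenEmbedding_subtypeVal

/-- The identity component is an open subset of the Banach space `𝓑(H)/𝒦(H)`, and its manifold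
structure is that of an open subset. -/
instance : ChartedSpace (Calkin H) (identityComponent H) :=
  (isOpenEmbedding_coe H).singletonChartedSpace

/-- The identity component is a Banach-Lie group. -/
instance : LieGroup 𝓘(ℝ, Calkin H) ∞ (identityComponent H) where
  toIsManifold := (isOpenEmbedding_coe H).isManifold_singleton
  contMDiff_mul := by
    have hv : ContMDiff 𝓘(ℝ, Calkin H) 𝓘(ℝ, Calkin H) ∞
        (fun u : identityComponent H => ((u : (Calkin H)ˣ) : Calkin H)) :=
      contMDiff_isOpenEmbedding (isOpenEmbedding_coe H)
    apply ContMDiff.of_comp_isOpenEmbedding (isOpenEmbedding_coe H)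
    have h : ContMDiff (𝓘(ℝ, Calkin H).prod 𝓘(ℝ, Calkin H)) 𝓘(ℝ, Calkin H × Calkin H) ∞
        (fun x : identityComponent H × identityComponent H =>
          (((x.1 : (Calkin H)ˣ) : Calkin H), ((x.2 : (Calkin H)ˣ) : Calkin H))) :=
      (hv.comp contMDiff_fst).prodMk_space (hv.comp contMDiff_snd)
    exact (contMDiff_iff_contDiff.2 (contDiff_mul (𝕜 := ℝ) (𝔸 := Calkin H))).comp h
  contMDiff_inv := by
    have hv : ContMDiff 𝓘(ℝ, Calkin H) 𝓘(ℝ, Calkin H) ∞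
        (fun u : identityComponent H => ((u : (Calkin H)ˣ) : Calkin H)) :=
      contMDiff_isOpenEmbedding (isOpenEmbedding_coe H)
    apply ContMDiff.of_comp_isOpenEmbedding (isOpenEmbedding_coe H)
    have h : (fun u : identityComponent H => ((u : (Calkin H)ˣ) : Calkin H)) ∘
        (fun u : identityComponent H => u⁻¹) =
        Ring.inverse ∘ (fun u : identityComponent H => ((u : (Calkin H)ˣ) : Calkin H)) := by
      ext u
      simp
    rw [h]
    intro u
    refine ContMDiffAt.comp u ?_ (hv u)
    rw [contMDiffAt_iff_contDiffAt]
    exact contDiffAt_ringInverse ℝ (u : (Calkin H)ˣ)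

variable {H} in
/-- The index `dim ker T - dim coker T` (used for Fredholm operators `T` only). -/
def index (T : H →L[ℂ] H) : ℤ :=
  (Module.finrank ℂ T.ker : ℤ) - (Module.finrank ℂ (H ⧸ T.range) : ℤ)

/-- The set `𝓕(H)` of Fredholm operators on `H`. -/
def fredholm : Set (H →L[ℂ] H) := {T | T.IsFredholm}

end CalkinRemark

end

/-! Everything on the operator side is measured against the set of operators `A + F` with `A`
invertible and `F` of finite rank. It equals the set of Fredholm operators of index 0: such an
operator becomes invertible after adding an isomorphism from its kernel to a complement of its
range, and conversely `1 + F` has index 0 by rank-nullity on the range of `F`. The set is open. It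
is connected because the invertible group is: polar decomposition reduces to a unitary, which is
joined to 1 through a square root of -1. Multiplication by powers of a shift and of its left inverse
carries index 0 to any index `k`, which gives the components of the Fredholm operators. Since
compact operators are norm limits of finite-rank ones, invertible plus compact gives the same set
again.

On the Calkin side, openness of `Q` makes `ι` an open embedding into the Calkin algebra. Its range
is a connected open subgroup, hence the identity component (`range_iota`), and the class of a
Fredholm operator of index 1 lies outside it.

Pulling back the chart along `ι` gives one Banach-Lie structure. For an arbitrary one, the
transition `P` between `ι` and a chart must be shown to be a diffeomorphism without any complement
to the kernel of `Q`. Two facts replace local sections: a map is smooth as soon as its composite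
with a bounded linear surjection is (`contDiffOn_image_of_comp`), and a surjective strict derivative
of a locally injective map is injective (`injective_of_hasStrictFDerivAt`), so that the inverse
function theorem applies. -/

noncomputable section

namespace CalkinRemark

/-! ### Connectedness of the invertible group of a Hilbert space. -/

section Connected

variable {E : Type*} [NormedAddCommGroup E] [InnerProductSpace ℂ E] [CompleteSpace E]

/-- A self-adjoint operator `b` has a self-adjoint unitary sign `s`, with `s * b = |b|`, which
commutes with every operator that doubly commutes with `b`. -/
theorem exists_sign_commute {b : E →L[ℂ] E} (hb : IsSelfAdjoint b) :
    ∃ s : E →L[ℂ] E, IsSelfAdjoint s ∧ s * s = 1 ∧ 0 ≤ s * b ∧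
      ∀ u : E →L[ℂ] E, Commute u b → Commute (star u) b → Commute s u := by
  have : CompleteSpace (b⁺).ker :=
    (ContinuousLinearMap.isClosed_ker (b⁺)).completeSpace_coe
  set e : E →L[ℂ] E := (b⁺).ker.starProjection with he
  have hee : e * e = e := (Submodule.isIdempotentElem_starProjection _)
  have hes : star e = e := (isSelfAdjoint_starProjection _)
  have hfix : ∀ T : E →L[ℂ] E, b⁺ * T = 0 → e * T = T := by
    intro T hT
    ext x
    exact (Submodule.starProjection_eq_self_iff (K := (b⁺).ker)).2
      (congrArg (fun S : E →L[ℂ] E => S x) hT)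
  have hqe : b⁺ * e = 0 := by
    ext x
    exact Submodule.starProjection_apply_mem (b⁺).ker x
  have hbp : star b⁺ = b⁺ := (CFC.posPart_nonneg b).isSelfAdjoint
  have heq : e * b⁺ = 0 := by
    simpa [hes, hbp] using congrArg star hqe
  have hen : e * b⁻ = b⁻ := hfix _ (CFC.posPart_mul_negPart b)
  have hbd : b = b⁺ - b⁻ := (CFC.posPart_sub_negPart b hb).symm
  -- The sign is -1 on `ker b⁺` and +1 on its orthogonal complement. Vectors in `ker b` get the sign
  -- -1, so the square is exactly 1.
  refine ⟨1 - (e + e), ?_, ?_, ?_, ?_⟩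
  · simp [IsSelfAdjoint, hes]
  · simp only [mul_sub, sub_mul, mul_add, add_mul, hee, one_mul, mul_one]
    abel
  · have : (1 - (e + e)) * b = b⁺ + b⁻ := by
      nth_rw 1 [hbd]
      simp only [mul_sub, sub_mul, add_mul, heq, hen, one_mul]
      abel
    rw [this]
    exact add_nonneg (CFC.posPart_nonneg b) (CFC.negPart_nonneg b)
  -- `ker b⁺` is invariant under `u` and under `star u`, so its projection commutes with `u`.
  · have key : ∀ u : E →L[ℂ] E, Commute u b → e * (u * e) = u * e := by
      intro u hu
      apply hfix
      have : Commute u b⁺ := by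
        rw [CFC.posPart_def]
        exact (hu.symm.cfcₙ_real _).symm
      rw [← mul_assoc, ← this.eq, mul_assoc, hqe, mul_zero]
    intro u hu hu'
    have h1 := key u hu
    have h2 := congrArg star (key _ hu')
    simp only [star_mul, star_star, hes] at h2
    have h3 : Commute e u := by
      rw [commute_iff_eq, ← h1, ← mul_assoc, h2]
    exact (Commute.one_left u).sub_left (h3.add_left h3)

theorem isStrictlyPositive_smul_one {c : ℝ} (hc : 0 < c) :
    IsStrictlyPositive (c • (1 : E →L[ℂ] E)) :=
  IsStrictlyPositive.smul hc (by cfc_tac)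

/-- Every point `T` of the segment from `u` to `J` is normal, and `star T * T` is a positive scalar
plus a nonnegative operator, hence invertible. -/
theorem joinedIn_isUnit_of_commute {u J : E →L[ℂ] E} (h1 : star u * u = 1) (h2 : u * star u = 1)
    (hJ : star J = -J) (hJJ : J * J = -1) (hJu : J * u = u * J) (hJu' : star u * J = J * star u)
    (hpos : 0 ≤ J * star u - J * u) :
    JoinedIn {x : E →L[ℂ] E | IsUnit x} u J := by
  refine JoinedIn.ofLine (f := fun t : ℝ => (1 - t) • u + t • J) (by fun_prop)
    (by simp) (by simp) ?_
  rintro _ ⟨t, ⟨ht0, ht1⟩, rfl⟩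
  set T : E →L[ℂ] E := (1 - t) • u + t • J with hT
  have hstar : star T = (1 - t) • star u - t • J := by
    simp [hT, hJ, sub_eq_add_neg]
  have hTT : star T * T = ((1 - t) ^ 2 + t ^ 2) • (1 : E →L[ℂ] E) +
      (t * (1 - t)) • (J * star u - J * u) := by
    rw [hstar, hT]
    simp only [sub_mul, mul_add, smul_mul_assoc, mul_smul_comm, h1, hJJ, hJu', smul_sub]
    module
  have hTT' : T * star T = star T * T := by
    rw [hTT, hstar, hT]
    simp only [mul_sub, add_mul, smul_mul_assoc, mul_smul_comm, h2, hJJ, ← hJu, smul_sub]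
    module
  have hunit : IsUnit (star T * T) := by
    rw [hTT]
    refine (IsStrictlyPositive.add_nonneg (isStrictlyPositive_smul_one ?_)
      (smul_nonneg ?_ hpos)).isUnit
    · nlinarith [sq_nonneg (1 - 2 * t)]
    · have : 0 ≤ 1 - t := by linarith
      positivity
  exact ((Commute.isUnit_mul_iff (a := star T) (b := T) hTT'.symm).1 hunit).2

/-- The path is `cos θ + sin θ J`, with inverse obtained by replacing `θ` with `-θ`. -/
theorem joinedIn_isUnit_one_of_mul_self_eq_neg_one {J : E →L[ℂ] E} (hJJ : J * J = -1) :
    JoinedIn {x : E →L[ℂ] E | IsUnit x} 1 J := by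
  refine JoinedIn.ofLine (f := fun t : ℝ => Real.cos (Real.pi / 2 * t) • (1 : E →L[ℂ] E) +
    Real.sin (Real.pi / 2 * t) • J) (by fun_prop) (by simp) (by simp) ?_
  rintro _ ⟨t, -, rfl⟩
  have h : ∀ θ : ℝ, (Real.cos θ • (1 : E →L[ℂ] E) + Real.sin θ • J) *
      (Real.cos (-θ) • (1 : E →L[ℂ] E) + Real.sin (-θ) • J) = 1 := by
    intro θ
    simp only [mul_add, add_mul, smul_mul_assoc, mul_smul_comm, mul_one, one_mul, hJJ,
      Real.cos_neg, Real.sin_neg]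
    have h1 : (1 : E →L[ℂ] E) = (Real.sin θ ^ 2 + Real.cos θ ^ 2) • (1 : E →L[ℂ] E) := by
      rw [Real.sin_sq_add_cos_sq, one_smul]
    conv_rhs => rw [h1]
    module
  refine isUnit_iff_exists.2 ⟨_, h _, ?_⟩
  simpa using h (-(Real.pi / 2 * t))

/-- With `b` the imaginary part of `u` and `s` its sign, `J = i s` is a square root of -1 on the
same side as `u`: `J (star u - u) = 2 s b ≥ 0`. This avoids taking a logarithm of `u`. -/
theorem joinedIn_isUnit_unitary {u : E →L[ℂ] E} (h1 : star u * u = 1) (h2 : u * star u = 1) :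
    JoinedIn {x : E →L[ℂ] E | IsUnit x} u 1 := by
  set b : E →L[ℂ] E := (Complex.I / 2) • (star u - u) with hb
  have hbs : IsSelfAdjoint b := by
    simp only [IsSelfAdjoint, hb, star_smul, star_sub, star_star, RCLike.star_def, map_div₀,
      Complex.conj_I, map_ofNat]
    rw [← neg_sub u (star u)]
    module
  obtain ⟨s, hs, hss, hsb, hcomm⟩ := exists_sign_commute hbs
  have hs' : star s = s := hs
  have hub : Commute u b := by
    refine Commute.smul_right (Commute.sub_right ?_ (Commute.refl u)) _
    rw [commute_iff_eq, h1, h2]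
  have hub' : Commute (star u) b := by
    refine Commute.smul_right (Commute.sub_right (Commute.refl _) ?_) _
    rw [commute_iff_eq, h1, h2]
  have hsu : s * u = u * s := hcomm u hub hub'
  have hsu' : star u * s = s * star u := by simpa [hs'] using congrArg star hsu
  obtain ⟨J, hJs⟩ : ∃ J : E →L[ℂ] E, J = Complex.I • s := ⟨_, rfl⟩
  have hJ : star J = -J := by simp [hJs, hs']
  have hJJ : J * J = -1 := by
    rw [hJs, smul_mul_smul_comm, hss, Complex.I_mul_I, neg_smul, one_smul]
  have hJu : J * u = u * J := by rw [hJs, smul_mul_assoc, hsu, mul_smul_comm]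
  have hJu' : star u * J = J * star u := by rw [hJs, smul_mul_assoc, ← hsu', mul_smul_comm]
  have hIb : J * star u - J * u = (2 : ℝ) • (s * b) := by
    rw [hb, hJs, smul_mul_assoc, smul_mul_assoc, ← smul_sub, mul_smul_comm, ← mul_sub,
      ← Complex.coe_smul, smul_smul]
    congr 1
    push_cast
    ring
  exact (joinedIn_isUnit_of_commute h1 h2 hJ hJJ hJu hJu' (hIb ▸ smul_nonneg zero_le_two hsb)).trans
    (joinedIn_isUnit_one_of_mul_self_eq_neg_one hJJ).symm

/-- Polar decomposition: `a = (a p⁻¹) p` with `p = |a|`. The positive factor is deformed linearly to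
1, which leaves the unitary `a p⁻¹`. -/
theorem joinedIn_isUnit_one {a : E →L[ℂ] E} (ha : IsUnit a) :
    JoinedIn {x : E →L[ℂ] E | IsUnit x} a 1 := by
  have hc : IsStrictlyPositive (star a * a) :=
    (IsUnit.mul ha.star ha).isStrictlyPositive (star_mul_self_nonneg a)
  set p := CFC.sqrt (star a * a) with hp
  have hpp : p * p = star a * a := CFC.sqrt_mul_sqrt_self _ hc.nonneg
  have hps : IsStrictlyPositive p := hc.sqrt
  obtain ⟨q, hq⟩ := hps.isUnit
  obtain ⟨v, hv⟩ := ha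
  have hsp : star p = p := hps.nonneg.isSelfAdjoint
  set r : E →L[ℂ] E := ((q⁻¹ : (E →L[ℂ] E)ˣ) : E →L[ℂ] E)
  have hpr : p * r = 1 := by rw [← hq]; exact q.mul_inv
  have hrp : r * p = 1 := by rw [← hq]; exact q.inv_mul
  have hsr : star r = r := by
    have : star r * p = 1 := by simpa [hsp] using congrArg star hpr
    calc star r = star r * (p * r) := by rw [hpr, mul_one]
      _ = r := by rw [← mul_assoc, this, one_mul]
  have hu : star (a * r) * (a * r) = 1 := by
    rw [star_mul, hsr, mul_assoc, ← mul_assoc (star a), ← hpp, mul_assoc, hpr, mul_one, hrp]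
  have hur : IsUnit (a * r) := ⟨v * q⁻¹, by simp [hv, r]⟩
  have hu' : a * r * star (a * r) = 1 := by
    obtain ⟨w, hw⟩ := hur
    rw [← hw] at hu ⊢
    have : star (w : E →L[ℂ] E) = (w⁻¹ : (E →L[ℂ] E)ˣ) := (Units.inv_eq_of_mul_eq_one_left hu).symm
    rw [this, w.mul_inv]
  refine JoinedIn.trans ?_ (joinedIn_isUnit_unitary hu hu')
  refine JoinedIn.ofLine (f := fun t : ℝ => a * (r * ((1 - t) • p + t • (1 : E →L[ℂ] E))))
    (by fun_prop) (by simp [hrp]) (by simp) ?_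
  rintro _ ⟨t, ⟨ht0, ht1⟩, rfl⟩
  refine IsUnit.mul ⟨v, hv⟩ (IsUnit.mul ⟨q⁻¹, rfl⟩ ?_)
  rcases ht0.eq_or_lt with rfl | ht
  · simpa using hps.isUnit
  · exact (IsStrictlyPositive.nonneg_add (smul_nonneg (by linarith) hps.nonneg)
      (isStrictlyPositive_smul_one ht)).isUnit

variable (E) in
/-- The group of invertible operators on a complex Hilbert space is connected. -/
theorem connectedSpace_units : ConnectedSpace (E →L[ℂ] E)ˣ := by
  have h : IsPathConnected {x : E →L[ℂ] E | IsUnit x} :=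
    ⟨1, isUnit_one, fun {_} hy => (joinedIn_isUnit_one hy).symm⟩
  have h2 : IsPreconnected (Set.univ : Set (E →L[ℂ] E)ˣ) := by
    rw [← (Units.isOpenEmbedding_val (R := E →L[ℂ] E)).isInducing.isPreconnected_image,
      Set.image_univ]
    exact h.isConnected.isPreconnected
  exact { isPreconnected_univ := h2, toNonempty := ⟨1⟩ }

end Connected

/-! ### Dimensions of kernels and cokernels. -/

section LinearAlgebra

variable {𝕜 V : Type*} [Field 𝕜] [AddCommGroup V] [Module 𝕜 V]

/-- Kernel and cokernel of `id + f` agree with those of its restriction to the finite-dimensional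
range of `f`, where rank-nullity applies. -/
theorem finrank_ker_one_add_eq {f : V →ₗ[𝕜] V} (hf : f.HasFiniteRange) :
    Module.finrank 𝕜 (LinearMap.id + f).ker = Module.finrank 𝕜 (V ⧸ (LinearMap.id + f).range) := by
  have : FiniteDimensional 𝕜 f.range := .of_fg hf
  set g : V →ₗ[𝕜] V := LinearMap.id + f with hg
  have hgx : ∀ x, g x = x + f x := fun x => rfl
  have hmaps : ∀ x ∈ f.range, g x ∈ f.range := fun x hx =>
    add_mem hx (LinearMap.mem_range_self f x)
  set h : f.range →ₗ[𝕜] f.range := g.restrict hmaps with hh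
  have hker : Module.finrank 𝕜 g.ker = Module.finrank 𝕜 h.ker := by
    have : g.ker = h.ker.map f.range.subtype := by
      ext x
      constructor
      · intro hx
        have hx' : x + f x = 0 := hx
        have hxr : x ∈ f.range := ⟨-x, by rw [map_neg]; exact (eq_neg_of_add_eq_zero_left hx').symm⟩
        exact ⟨⟨x, hxr⟩, Subtype.ext hx, rfl⟩
      · rintro ⟨⟨y, hy⟩, hyk, rfl⟩
        exact congrArg Subtype.val hyk
    rw [this, Submodule.finrank_map_subtype_eq]
  have hcoker : Module.finrank 𝕜 (V ⧸ g.range) = Module.finrank 𝕜 (f.range ⧸ h.range) := by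
    have hle : h.range ≤ g.range.comap f.range.subtype := by
      rintro _ ⟨x, rfl⟩
      exact ⟨x, rfl⟩
    refine (LinearEquiv.finrank_eq (LinearEquiv.ofBijective
      (h.range.mapQ g.range f.range.subtype hle) ⟨?_, ?_⟩)).symm
    · rw [← LinearMap.ker_eq_bot, Submodule.ker_mapQ, eq_bot_iff, Submodule.map_le_iff_le_comap,
        Submodule.comap_bot, Submodule.ker_mkQ]
      rintro ⟨w, hw⟩ ⟨x, hx⟩
      have hx' : x + f x = w := hx
      have hxr : x ∈ f.range := by
        rw [eq_sub_of_add_eq hx']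
        exact sub_mem hw (LinearMap.mem_range_self f x)
      exact ⟨⟨x, hxr⟩, Subtype.ext hx⟩
    · rintro ⟨v⟩
      refine ⟨Submodule.Quotient.mk ⟨-f v, neg_mem (LinearMap.mem_range_self f v)⟩, ?_⟩
      refine (Submodule.Quotient.eq _).2 ⟨-v, ?_⟩
      simp [hgx, sub_eq_add_neg, add_comm]
  rw [hker, hcoker]
  have h1 := h.finrank_range_add_finrank_ker
  have h2 := h.range.finrank_quotient_add_finrank
  omega

theorem finrank_ker_comp_of_surjective {V₂ V₃ : Type*} [AddCommGroup V₂] [Module 𝕜 V₂]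
    [AddCommGroup V₃] [Module 𝕜 V₃] {f : V₂ →ₗ[𝕜] V₃} {g : V →ₗ[𝕜] V₂}
    (hg : Function.Surjective g) [FiniteDimensional 𝕜 (f ∘ₗ g).ker] :
    Module.finrank 𝕜 (f ∘ₗ g).ker = Module.finrank 𝕜 f.ker + Module.finrank 𝕜 g.ker := by
  set h : (f ∘ₗ g).ker →ₗ[𝕜] f.ker := g.restrict fun x hx => hx
  have hs : Function.Surjective h := by
    rintro ⟨y, hy⟩
    obtain ⟨x, rfl⟩ := hg y
    exact ⟨⟨x, hy⟩, rfl⟩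
  have hk : g.ker = h.ker.map (f ∘ₗ g).ker.subtype := by
    ext x
    constructor
    · intro hx
      have hx' : g x = 0 := hx
      exact ⟨⟨x, by simp [hx']⟩, Subtype.ext hx', rfl⟩
    · rintro ⟨⟨y, hy⟩, hyk, rfl⟩
      exact congrArg Subtype.val hyk
  rw [hk, Submodule.finrank_map_subtype_eq, ← h.finrank_range_add_finrank_ker,
    LinearMap.range_eq_top.2 hs, finrank_top]

/-- Additivity along `0 → V₂/ran g → V₃/ran (f g) → V₃/ran f → 0`. Finiteness matters because
`finrank` is 0 in infinite dimension. -/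
theorem finrank_quotient_range_comp_of_injective {V₂ V₃ : Type*} [AddCommGroup V₂] [Module 𝕜 V₂]
    [AddCommGroup V₃] [Module 𝕜 V₃] {f : V₂ →ₗ[𝕜] V₃} {g : V →ₗ[𝕜] V₂}
    (hf : Function.Injective f) [FiniteDimensional 𝕜 (V₃ ⧸ (f ∘ₗ g).range)] :
    Module.finrank 𝕜 (V₃ ⧸ (f ∘ₗ g).range) =
      Module.finrank 𝕜 (V₂ ⧸ g.range) + Module.finrank 𝕜 (V₃ ⧸ f.range) := by
  have hle : (f ∘ₗ g).range ≤ f.range := LinearMap.range_comp_le_range g f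
  have hle' : g.range ≤ (f ∘ₗ g).range.comap f := by
    rintro _ ⟨x, rfl⟩
    exact ⟨x, rfl⟩
  set h : (V₂ ⧸ g.range) →ₗ[𝕜] (V₃ ⧸ (f ∘ₗ g).range) := g.range.mapQ _ f hle' with hh
  have hinj : Function.Injective h := by
    rw [← LinearMap.ker_eq_bot, Submodule.ker_mapQ, eq_bot_iff, Submodule.map_le_iff_le_comap,
      Submodule.comap_bot, Submodule.ker_mkQ]
    rintro x ⟨y, hy⟩
    exact ⟨y, hf hy⟩
  have hrange : h.range = f.range.map (f ∘ₗ g).range.mkQ := by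
    rw [hh, Submodule.range_mapQ]
  rw [← (Submodule.quotientQuotientEquivQuotient _ _ hle).finrank_eq, ← hrange,
    ← LinearMap.finrank_range_of_inj hinj, add_comm, Submodule.finrank_quotient_add_finrank]

end LinearAlgebra

/-! ### Fredholm operators and the index. -/

section Index

open LinearMap.FiniteRangeSetoid

variable {E : Type*} [NormedAddCommGroup E] [InnerProductSpace ℂ E]

theorem isFredholm_comp {S T : E →L[ℂ] E} (hS : S.IsFredholm) (hT : T.IsFredholm) :
    (S * T).IsFredholm := by
  obtain ⟨S', hS'⟩ := hS.exists_isQuasiInverse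
  obtain ⟨T', hT'⟩ := hT.exists_isQuasiInverse
  exact ContinuousLinearMap.IsFredholm.of_isQuasiInverse (v := T' * S') (hT'.comp hS')

/-- The sum of an invertible and a finite-rank operator is a Fredholm operator. -/
theorem isFredholm_of_sub_hasFiniteRange {T : E →L[ℂ] E} (A : (E →L[ℂ] E)ˣ)
    (h : ((T - A : E →L[ℂ] E) : E →ₗ[ℂ] E).HasFiniteRange) : T.IsFredholm := by
  refine ContinuousLinearMap.IsFredholm.of_isQuasiInverse
    (v := ((A⁻¹ : (E →L[ℂ] E)ˣ) : E →L[ℂ] E)) ?_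
  have hTA : (T : E →ₗ[ℂ] E) ≈ ((A : E →L[ℂ] E) : E →ₗ[ℂ] E) :=
    LinearMap.FiniteRangeSetoid.equiv_iff_hasFiniteRange.2 h
  refine LinearMap.IsQuasiInverse.congr (v := ((A : E →L[ℂ] E) : E →ₗ[ℂ] E)) ?_ (Setoid.refl _) hTA
  have h1 : (((A⁻¹ : (E →L[ℂ] E)ˣ) : E →L[ℂ] E) : E →ₗ[ℂ] E) ∘ₗ ((A : E →L[ℂ] E) : E →ₗ[ℂ] E) =
      LinearMap.id := congrArg (fun S : E →L[ℂ] E => (S : E →ₗ[ℂ] E)) A.inv_mul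
  have h2 : ((A : E →L[ℂ] E) : E →ₗ[ℂ] E) ∘ₗ (((A⁻¹ : (E →L[ℂ] E)ˣ) : E →L[ℂ] E) : E →ₗ[ℂ] E) =
      LinearMap.id := congrArg (fun S : E →L[ℂ] E => (S : E →ₗ[ℂ] E)) A.mul_inv
  exact ⟨by rw [LinearMap.IsLeftQuasiInverse, h1], by rw [LinearMap.IsRightQuasiInverse, h2]⟩

/-- Together with its injective counterpart, this replaces the general product formula for the
index: the factors to be used are shifts. -/
theorem index_mul_of_surjective {S T : E →L[ℂ] E} (hS : S.IsFredholm) (hT : T.IsFredholm)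
    (hsurj : Function.Surjective S) :
    index (T * S) = index T + Module.finrank ℂ S.ker := by
  have hTS : FiniteDimensional ℂ ((T : E →ₗ[ℂ] E) ∘ₗ (S : E →ₗ[ℂ] E)).ker :=
    (isFredholm_comp hT hS).finite_ker
  have h1 : Module.finrank ℂ (T * S).ker = _ :=
    finrank_ker_comp_of_surjective (f := (T : E →ₗ[ℂ] E)) (g := (S : E →ₗ[ℂ] E)) hsurj
  have h2 : (T * S).range = T.range :=
    LinearMap.range_comp_of_range_eq_top (T : E →ₗ[ℂ] E) (LinearMap.range_eq_top.2 hsurj)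
  rw [index, index, h1, h2]
  push_cast
  ring

theorem index_mul_of_injective {R T : E →L[ℂ] E} (hR : R.IsFredholm) (hT : T.IsFredholm)
    (hinj : Function.Injective R) :
    index (R * T) = index T - Module.finrank ℂ (E ⧸ R.range) := by
  have hRT : FiniteDimensional ℂ (E ⧸ ((R : E →ₗ[ℂ] E) ∘ₗ (T : E →ₗ[ℂ] E)).range) :=
    (isFredholm_comp hR hT).finite_coker
  have h1 : Module.finrank ℂ (E ⧸ (R * T).range) = _ :=
    finrank_quotient_range_comp_of_injective (f := (R : E →ₗ[ℂ] E)) (g := (T : E →ₗ[ℂ] E)) hinj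
  have h2 : (R * T).ker = T.ker :=
    LinearMap.ker_comp_of_ker_eq_bot (T : E →ₗ[ℂ] E) (LinearMap.ker_eq_bot.2 hinj)
  rw [index, index, h1, h2]
  push_cast
  ring

theorem index_eq_zero_of_sub_hasFiniteRange {T : E →L[ℂ] E} (A : (E →L[ℂ] E)ˣ)
    (h : ((T - A : E →L[ℂ] E) : E →ₗ[ℂ] E).HasFiniteRange) : index T = 0 := by
  set f : E →ₗ[ℂ] E := ((((A⁻¹ : (E →L[ℂ] E)ˣ) : E →L[ℂ] E) * (T - A) : E →L[ℂ] E) : E →ₗ[ℂ] E)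
    with hf
  have hfr : f.HasFiniteRange := h.comp_left _
  have hinv : Function.Bijective (A : E →L[ℂ] E) := by
    refine Function.bijective_iff_has_inverse.2 ⟨((A⁻¹ : (E →L[ℂ] E)ˣ) : E →L[ℂ] E), ?_, ?_⟩
    · exact fun x => congrArg (fun S : E →L[ℂ] E => S x) A.inv_mul
    · exact fun x => congrArg (fun S : E →L[ℂ] E => S x) A.mul_inv
  have hT : (T : E →ₗ[ℂ] E) = ((A : E →L[ℂ] E) : E →ₗ[ℂ] E) ∘ₗ (LinearMap.id + f) := by
    have : T = A * (1 + ((A⁻¹ : (E →L[ℂ] E)ˣ) : E →L[ℂ] E) * (T - A)) := by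
      rw [mul_add, ← mul_assoc, A.mul_inv]
      simp
    exact congrArg (fun S : E →L[ℂ] E => (S : E →ₗ[ℂ] E)) this
  have hfin : FiniteDimensional ℂ
      (E ⧸ (((A : E →L[ℂ] E) : E →ₗ[ℂ] E) ∘ₗ (LinearMap.id + f)).range) := by
    rw [← hT]
    exact (isFredholm_of_sub_hasFiniteRange A h).finite_coker
  have h0 : Module.finrank ℂ (E ⧸ ((A : E →L[ℂ] E) : E →ₗ[ℂ] E).range) = 0 := by
    rw [LinearMap.range_eq_top.2 hinv.2]
    exact Module.finrank_zero_of_subsingleton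
  rw [index, hT, finrank_quotient_range_comp_of_injective hinv.1, h0,
    LinearMap.ker_comp_of_ker_eq_bot _ (LinearMap.ker_eq_bot.2 hinv.1),
    finrank_ker_one_add_eq hfr]
  simp

/-- A Fredholm operator of index zero is the sum of an invertible and a finite-rank operator. -/
theorem exists_unit_sub_hasFiniteRange [CompleteSpace E] {T : E →L[ℂ] E} (hT : T.IsFredholm)
    (h0 : index T = 0) :
    ∃ A : (E →L[ℂ] E)ˣ, ((T - A : E →L[ℂ] E) : E →ₗ[ℂ] E).HasFiniteRange := by
  obtain ⟨M, hM⟩ := hT.closedComplemented_range.exists_isTopCompl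
  obtain ⟨N, hN⟩ := hT.closedComplemented_ker.exists_isTopCompl
  have := hT.finite_ker
  have hfc : FiniteDimensional ℂ (E ⧸ T.range) := hT.finite_coker
  have e1 : (E ⧸ T.range) ≃ₗ[ℂ] M := Submodule.quotientEquivOfIsCompl _ _ hM.isCompl
  have : FiniteDimensional ℂ M := e1.finiteDimensional
  have hdim : Module.finrank ℂ T.ker = Module.finrank ℂ M := by
    rw [← e1.finrank_eq]
    rw [index] at h0
    omega
  obtain ⟨φ⟩ : Nonempty (T.ker ≃L[ℂ] M) := ⟨ContinuousLinearEquiv.ofFinrankEq hdim⟩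
  -- The correction `F` sends `ker T` isomorphically onto the complement `M` of the range and kills
  -- `N`; index 0 is what makes the two dimensions equal.
  set F : E →L[ℂ] E := M.subtypeL ∘L (φ : T.ker →L[ℂ] M) ∘L T.ker.projectionOntoL N hN with hF
  have hFfin : (F : E →ₗ[ℂ] E).HasFiniteRange := by
    have : (M.subtype : M →ₗ[ℂ] E).HasFiniteRange := LinearMap.HasFiniteRange.of_finite_dom
    exact this.comp_right _
  have hFM : ∀ x, F x ∈ M := fun x => Subtype.property _
  have hbij : Function.Bijective (T + F) := by
    constructor
    · refine (injective_iff_map_eq_zero (T + F)).2 fun x hx => ?_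
      have hx' : T x + F x = 0 := hx
      have hTx : T x = 0 := by
        refine Submodule.disjoint_def.1 hM.isCompl.disjoint _ (LinearMap.mem_range_self _ x) ?_
        have : T x = -F x := eq_neg_of_add_eq_zero_left hx'
        rw [this]
        exact neg_mem (hFM x)
      have hFx : F x = 0 := by rwa [hTx, zero_add] at hx'
      have h2 : (T.ker.projectionOntoL N hN) x = 0 := by
        have : (φ (T.ker.projectionOntoL N hN x) : E) = 0 := hFx
        simpa using this
      have h3 : T.ker.projectionOntoL N hN x = (⟨x, hTx⟩ : T.ker) :=
        Submodule.projectionOnto_apply_left hN.isCompl (⟨x, hTx⟩ : T.ker)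
      rw [h3] at h2
      exact congrArg Subtype.val h2
    · intro y
      obtain ⟨_, ⟨x, rfl⟩, m, hm, rfl⟩ := Submodule.mem_sup.1
        (show y ∈ T.range ⊔ M by rw [hM.isCompl.sup_eq_top]; trivial)
      obtain ⟨k, hk, n, hn, rfl⟩ := Submodule.mem_sup.1
        (show x ∈ T.ker ⊔ N by rw [hN.isCompl.sup_eq_top]; trivial)
      set z := φ.symm ⟨m, hm⟩ with hz
      refine ⟨n + z, ?_⟩
      have hk0 : T k = 0 := hk
      have hz0 : T (z : E) = 0 := z.2
      have hFn : F n = 0 := by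
        have : T.ker.projectionOntoL N hN n = 0 :=
          Submodule.projectionOnto_apply_right hN.isCompl (⟨n, hn⟩ : N)
        simp [hF, this]
      have hFz : F z = m := by simp [hF, hz]
      simp [hk0, hz0, hFn, hFz]
  obtain ⟨A, hA⟩ := ContinuousLinearMap.isUnit_iff_bijective.2 hbij
  refine ⟨A, ?_⟩
  rw [hA]
  simpa using hFfin.neg

end Index

/-! ### The unilateral shift. -/

section Separable

variable (E : Type*) [NormedAddCommGroup E] [InnerProductSpace ℂ E] [CompleteSpace E]
  [TopologicalSpace.SeparableSpace E]

theorem nonempty_linearIsometryEquiv_lp (hE : ¬ FiniteDimensional ℂ E) :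
    Nonempty (E ≃ₗᵢ[ℂ] lp (fun _ : ℕ => ℂ) 2) := by
  obtain ⟨w, b, hb⟩ := exists_hilbertBasis ℂ E
  have horth : Orthonormal ℂ ((↑) : w → E) := hb ▸ b.orthonormal
  have hdisc : DiscreteTopology w := by
    -- Distinct orthonormal vectors are at distance `√2`, so the basis is discrete, hence countable
    -- by separability.
    refine DiscreteTopology.of_forall_le_dist (r := 1) one_pos fun x y hxy => ?_
    have h2 : ‖(x : E) - y‖ ^ 2 = 2 := by
      have := norm_sub_pow_two (𝕜 := ℂ) (x : E) (y : E)
      rw [horth.1 x, horth.1 y, horth.2 hxy] at this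
      rw [this]; norm_num
    change (1 : ℝ) ≤ dist (x : E) y
    rw [dist_eq_norm]
    nlinarith [norm_nonneg ((x : E) - y)]
  have : SecondCountableTopology E := UniformSpace.secondCountable_of_separable E
  have hcount : Countable w := TopologicalSpace.separableSpace_iff_countable.1 inferInstance
  have hinf : Infinite w := by
    by_contra hfin
    rw [not_infinite_iff_finite] at hfin
    have := Fintype.ofFinite w
    exact hE b.toOrthonormalBasis.toBasis.finiteDimensional_of_finite
  obtain ⟨e⟩ := nonempty_equiv_of_countable (α := ℕ) (β := w)
  have hb' : Orthonormal ℂ (b ∘ e) := b.orthonormal.comp e e.injective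
  refine ⟨(HilbertBasis.mk hb' ?_).repr⟩
  rw [Set.range_comp, e.range_eq_univ, Set.image_univ, b.dense_span]

/-- A separable infinite-dimensional Hilbert space carries a unilateral shift `R` together with a
left inverse `S`. -/
theorem exists_shift (hE : ¬ FiniteDimensional ℂ E) :
    ∃ R S : E →L[ℂ] E, S * R = 1 ∧ Module.finrank ℂ S.ker = 1 ∧
      Module.finrank ℂ (E ⧸ R.range) = 1 ∧ R.IsFredholm ∧ S.IsFredholm ∧
      ((R * S - 1 : E →L[ℂ] E) : E →ₗ[ℂ] E).HasFiniteRange := by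
  have : Nontrivial E := by
    by_contra h
    rw [not_nontrivial_iff_subsingleton] at h
    exact hE inferInstance
  obtain ⟨v, hv⟩ := exists_ne (0 : E)
  set L : Submodule ℂ E := ℂ ∙ v with hL
  have hLc : IsCompl Lᗮ L := (Submodule.isCompl_orthogonal (K := L)).symm
  have hfd : ¬ FiniteDimensional ℂ Lᗮ := by
    intro h
    exact hE (LinearEquiv.finiteDimensional (Submodule.prodEquivOfIsCompl _ _ hLc))
  obtain ⟨e₁⟩ := nonempty_linearIsometryEquiv_lp E hE
  obtain ⟨e₂⟩ := nonempty_linearIsometryEquiv_lp Lᗮ hfd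
  -- Removing the line `L` leaves a space isomorphic to `E`; this isomorphism is the shift, with
  -- cokernel of dimension 1.
  set e : E ≃L[ℂ] Lᗮ := (e₁.trans e₂.symm).toContinuousLinearEquiv
  set R : E →L[ℂ] E := Lᗮ.subtypeL ∘L (e : E →L[ℂ] Lᗮ) with hR
  set S : E →L[ℂ] E := (e.symm : Lᗮ →L[ℂ] E) ∘L Lᗮ.orthogonalProjectionOnto with hS
  have hSR : S * R = 1 := by
    ext x
    simp [hS, hR]
  have hker : S.ker = L := by
    ext x
    simp [hS]
  have hrange : R.range = Lᗮ := by
    ext x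
    constructor
    · rintro ⟨y, rfl⟩
      exact (e y).2
    · intro hx
      exact ⟨e.symm ⟨x, hx⟩, by simp [hR]⟩
  have hfin : LinearMap.HasFiniteRange ((R * S - 1 : E →L[ℂ] E) : E →ₗ[ℂ] E) := by
    have hle : ((R * S - 1 : E →L[ℂ] E) : E →ₗ[ℂ] E).range ≤ L := by
      rintro _ ⟨x, rfl⟩
      rw [← hker]
      change S ((R * S - 1) x) = 0
      have : S * (R * S - 1) = 0 := by rw [mul_sub, ← mul_assoc, hSR]; simp
      exact congrArg (fun T : E →L[ℂ] E => T x) this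
    have : FiniteDimensional ℂ L := inferInstance
    exact Submodule.fg_iff_finiteDimensional _ |>.2 (Submodule.finiteDimensional_of_le hle)
  have hquasi : S.IsQuasiInverse (R : E →ₗ[ℂ] E) := by
    constructor
    · have : (S : E →ₗ[ℂ] E) ∘ₗ (R : E →ₗ[ℂ] E) = LinearMap.id :=
        congrArg (fun T : E →L[ℂ] E => (T : E →ₗ[ℂ] E)) hSR
      rw [LinearMap.IsLeftQuasiInverse, this]
    · exact LinearMap.FiniteRangeSetoid.equiv_iff_hasFiniteRange.2 hfin
  refine ⟨R, S, hSR, ?_, ?_, .of_isQuasiInverse hquasi, .of_isQuasiInverse hquasi.symm, hfin⟩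
  · rw [hker, hL, finrank_span_singleton hv]
  · rw [hrange, (Submodule.quotientEquivOfIsCompl _ _ hLc).finrank_eq, hL,
      finrank_span_singleton hv]

end Separable

/-! ### Compact and finite-rank operators. -/

section Compact

variable {E F : Type*} [NormedAddCommGroup E] [NormedSpace ℂ E]
  [NormedAddCommGroup F] [InnerProductSpace ℂ F]

/-- Compose `T` with the orthogonal projection onto the span of a finite `ε`-net of a compact set
containing the image of the unit ball. -/
theorem exists_hasFiniteRange_norm_sub_lt {T : E →L[ℂ] F} (hT : IsCompactOperator T)
    {ε : ℝ} (hε : 0 < ε) :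
    ∃ S : E →L[ℂ] F, (S : E →ₗ[ℂ] F).HasFiniteRange ∧ ‖T - S‖ ≤ ε := by
  obtain ⟨C, hC, hsub⟩ := hT.image_closedBall_subset_compact 1
  obtain ⟨t, -, htf, hcov⟩ := hC.finite_cover_balls hε
  set W : Submodule ℂ F := Submodule.span ℂ t with hW
  have : FiniteDimensional ℂ W := FiniteDimensional.span_of_finite ℂ htf
  refine ⟨W.starProjection ∘L T, ?_, ?_⟩
  · refine LinearMap.HasFiniteRange.comp_right (v := (W.starProjection : F →ₗ[ℂ] F)) ?_ _
    rw [LinearMap.HasFiniteRange, Submodule.range_starProjection]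
    exact Submodule.fg_iff_finiteDimensional _ |>.2 this
  · refine ContinuousLinearMap.opNorm_le_of_unit_norm hε.le fun x hx => ?_
    have hmem : T x ∈ C := hsub ⟨x, by simp [hx], rfl⟩
    obtain ⟨y, hy, hyx⟩ := Set.mem_iUnion₂.1 (hcov hmem)
    have h1 : ‖T x - W.starProjection (T x)‖ ≤ ‖T x - y‖ := by
      rw [Submodule.starProjection_minimal]
      exact ciInf_le (f := fun z : W => ‖T x - z‖) ⟨0, by rintro _ ⟨z, rfl⟩; exact norm_nonneg _⟩
        ⟨y, Submodule.subset_span hy⟩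
    rw [Metric.mem_ball, dist_eq_norm] at hyx
    exact h1.trans hyx.le

theorem isCompactOperator_of_hasFiniteRange {T : E →L[ℂ] F}
    (hT : (T : E →ₗ[ℂ] F).HasFiniteRange) : IsCompactOperator T := by
  have : FiniteDimensional ℂ T.range := .of_fg hT
  have h := isCompactOperator_id_iff_finiteDimensional (𝕜 := ℂ) |>.2 this
  have h2 := (h.clm_comp T.range.subtypeL).comp_clm
    (T.codRestrict T.range fun x => LinearMap.mem_range_self _ x)
  exact h2

end Compact

/-! ### Connected components of the Fredholm operators. -/

section Components

variable (E : Type*) [NormedAddCommGroup E] [InnerProductSpace ℂ E]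

/-- The operators that are a sum of an invertible and a finite-rank operator. -/
def unitAddFiniteRank : Set (E →L[ℂ] E) :=
  {T | ∃ A : (E →L[ℂ] E)ˣ, ((T - A : E →L[ℂ] E) : E →ₗ[ℂ] E).HasFiniteRange}

/-- The subspace of finite-rank operators. -/
def finiteRankOperators : Submodule ℂ (E →L[ℂ] E) :=
  (LinearMap.finiteRange ℂ E E).comap (ContinuousLinearMap.coeLM ℂ)

variable {E}

theorem mem_finiteRankOperators {T : E →L[ℂ] E} :
    T ∈ finiteRankOperators E ↔ (T : E →ₗ[ℂ] E).HasFiniteRange :=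
  LinearMap.mem_finiteRange_iff_hasFiniteRange

theorem isFredholm_of_mem {T : E →L[ℂ] E} (hT : T ∈ unitAddFiniteRank E) : T.IsFredholm :=
  let ⟨A, hA⟩ := hT
  isFredholm_of_sub_hasFiniteRange A hA

theorem index_eq_zero_of_mem {T : E →L[ℂ] E} (hT : T ∈ unitAddFiniteRank E) : index T = 0 :=
  let ⟨A, hA⟩ := hT
  index_eq_zero_of_sub_hasFiniteRange A hA

theorem one_mem_unitAddFiniteRank : (1 : E →L[ℂ] E) ∈ unitAddFiniteRank E := ⟨1, by simp⟩

theorem add_mem_unitAddFiniteRank {T F : E →L[ℂ] E} (hT : T ∈ unitAddFiniteRank E)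
    (hF : (F : E →ₗ[ℂ] E).HasFiniteRange) : T + F ∈ unitAddFiniteRank E := by
  obtain ⟨A, hA⟩ := hT
  refine ⟨A, ?_⟩
  have := hA.add hF
  rw [add_sub_right_comm]
  exact this

theorem unitAddFiniteRank_eq_image : unitAddFiniteRank E =
    (fun p : (E →L[ℂ] E)ˣ × (E →L[ℂ] E) => (p.1 : E →L[ℂ] E) + p.2) ''
      (Set.univ ×ˢ (finiteRankOperators E : Set (E →L[ℂ] E))) := by
  ext T
  constructor
  · rintro ⟨A, hA⟩
    exact ⟨(A, T - A), ⟨trivial, mem_finiteRankOperators.2 hA⟩, add_sub_cancel _ _⟩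
  · rintro ⟨⟨A, F⟩, ⟨-, hF⟩, rfl⟩
    exact ⟨A, by simpa using mem_finiteRankOperators.1 hF⟩

theorem mul_mem_unitAddFiniteRank_right {T P : E →L[ℂ] E} (hT : T ∈ unitAddFiniteRank E)
    (hP : ((P - 1 : E →L[ℂ] E) : E →ₗ[ℂ] E).HasFiniteRange) : T * P ∈ unitAddFiniteRank E := by
  have : T * P = T + T * (P - 1) := by rw [mul_sub, mul_one, add_sub_cancel]
  rw [this]
  exact add_mem_unitAddFiniteRank hT (hP.comp_left (T : E →ₗ[ℂ] E))

theorem mul_mem_unitAddFiniteRank_left {T P : E →L[ℂ] E} (hT : T ∈ unitAddFiniteRank E)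
    (hP : ((P - 1 : E →L[ℂ] E) : E →ₗ[ℂ] E).HasFiniteRange) : P * T ∈ unitAddFiniteRank E := by
  have : P * T = T + (P - 1) * T := by rw [sub_mul, one_mul, add_sub_cancel]
  rw [this]
  exact add_mem_unitAddFiniteRank hT (hP.comp_right (T : E →ₗ[ℂ] E))

variable {R S : E →L[ℂ] E}

theorem pow_mul_pow_eq_one (hSR : S * R = 1) (n : ℕ) : S ^ n * R ^ n = 1 := by
  induction n with
  | zero => simp
  | succ n ih => rw [pow_succ, pow_succ', mul_assoc, ← mul_assoc S, hSR, one_mul, ih]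

theorem isFredholm_pow (hR : R.IsFredholm) (n : ℕ) : (R ^ n).IsFredholm := by
  induction n with
  | zero => exact isFredholm_of_sub_hasFiniteRange 1 (by simp)
  | succ n ih => exact pow_succ R n ▸ isFredholm_comp ih hR

theorem index_pow_mul (hSR : S * R = 1) (hR : R.IsFredholm)
    (h1 : Module.finrank ℂ (E ⧸ R.range) = 1) {T : E →L[ℂ] E} (hT : T.IsFredholm) (n : ℕ) :
    index (R ^ n * T) = index T - n := by
  have hinj : Function.Injective R :=
    Function.LeftInverse.injective (g := S) fun x => congrArg (fun T : E →L[ℂ] E => T x) hSR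
  induction n with
  | zero => simp
  | succ n ih =>
    rw [pow_succ', mul_assoc, index_mul_of_injective hR (isFredholm_comp (isFredholm_pow hR n) hT)
      hinj, ih, h1]
    push_cast
    ring

theorem index_mul_pow (hSR : S * R = 1) (hS : S.IsFredholm)
    (h1 : Module.finrank ℂ S.ker = 1) {T : E →L[ℂ] E} (hT : T.IsFredholm) (n : ℕ) :
    index (T * S ^ n) = index T + n := by
  have hsurj : Function.Surjective S :=
    Function.RightInverse.surjective (g := R) fun x => congrArg (fun T : E →L[ℂ] E => T x) hSR
  induction n with
  | zero => simp
  | succ n ih =>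
    rw [pow_succ, ← mul_assoc, index_mul_of_surjective hS
      (isFredholm_comp hT (isFredholm_pow hS n)) hsurj, ih, h1]
    push_cast
    ring

theorem hasFiniteRange_pow_mul_pow_sub_one
    (hRS : ((R * S - 1 : E →L[ℂ] E) : E →ₗ[ℂ] E).HasFiniteRange) (n : ℕ) :
    ((R ^ n * S ^ n - 1 : E →L[ℂ] E) : E →ₗ[ℂ] E).HasFiniteRange := by
  induction n with
  | zero => simp
  | succ n ih =>
    have : R ^ (n + 1) * S ^ (n + 1) - 1 = R * ((R ^ n * S ^ n - 1) * S) + (R * S - 1) := by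
      rw [pow_succ', pow_succ, sub_mul, mul_sub, one_mul]
      simp only [mul_assoc]
      abel
    rw [this]
    exact ((ih.comp_right (S : E →ₗ[ℂ] E)).comp_left (R : E →ₗ[ℂ] E)).add hRS

variable [CompleteSpace E]

theorem mem_unitAddFiniteRank_iff {T : E →L[ℂ] E} :
    T ∈ unitAddFiniteRank E ↔ T.IsFredholm ∧ index T = 0 :=
  ⟨fun h => ⟨isFredholm_of_mem h, index_eq_zero_of_mem h⟩,
    fun h => exists_unit_sub_hasFiniteRange h.1 h.2⟩

/-- The set is a union of translates of the open set of invertible operators. -/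
theorem isOpen_unitAddFiniteRank : IsOpen (unitAddFiniteRank E) := by
  have : unitAddFiniteRank E = ⋃ F ∈ finiteRankOperators E,
      (fun T : E →L[ℂ] E => T - F) ⁻¹' {x | IsUnit x} := by
    ext T
    simp only [Set.mem_iUnion₂]
    constructor
    · rintro ⟨A, hA⟩
      exact ⟨T - A, mem_finiteRankOperators.2 hA, A, by simp⟩
    · rintro ⟨F, hF, A, hA⟩
      refine ⟨A, ?_⟩
      rw [hA]
      simpa using mem_finiteRankOperators.1 hF
  rw [this]
  exact isOpen_biUnion fun F _ => Units.isOpen.preimage (by fun_prop)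

theorem isPreconnected_unitAddFiniteRank : IsPreconnected (unitAddFiniteRank E) := by
  rw [unitAddFiniteRank_eq_image]
  have := connectedSpace_units E
  refine IsPreconnected.image ?_ _ ?_
  · refine isPreconnected_univ.prod (Convex.isPreconnected ?_)
    exact ((finiteRankOperators E).restrictScalars ℝ).convex
  · exact ((Units.continuous_val.comp continuous_fst).add continuous_snd).continuousOn

/-- The sum of an invertible and a compact operator is the sum of an invertible and a finite-rank
operator. -/
theorem mem_unitAddFiniteRank_of_isCompactOperator {T : E →L[ℂ] E} (A : (E →L[ℂ] E)ˣ)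
    (h : IsCompactOperator (T - A : E →L[ℂ] E)) : T ∈ unitAddFiniteRank E := by
  -- `T - X` is invertible at `X = T - A`, hence also at a nearby finite-rank `X`.
  have hopen : IsOpen ((fun X : E →L[ℂ] E => T - X) ⁻¹' {x | IsUnit x}) :=
    Units.isOpen.preimage (by fun_prop)
  obtain ⟨ε, hε, hball⟩ := Metric.isOpen_iff.1 hopen (T - A) ⟨A, by simp⟩
  obtain ⟨F, hF, hTF⟩ := exists_hasFiniteRange_norm_sub_lt h (half_pos hε)
  obtain ⟨B, hB⟩ := hball (show F ∈ Metric.ball (T - A : E →L[ℂ] E) ε by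
    rw [Metric.mem_ball, dist_comm, dist_eq_norm]
    linarith)
  exact ⟨B, by rw [hB]; simpa using hF⟩

/-- `T = (T S ^ n) R ^ n` recovers `T` from an operator of index 0. Conversely `B R ^ n S ^ n`
differs from `B` by finite rank, so it has index 0, and removing `S ^ n` lowers the index by `n`. -/
theorem setOf_index_eq_neg (hSR : S * R = 1) (hR : R.IsFredholm) (hS : S.IsFredholm)
    (hRS : ((R * S - 1 : E →L[ℂ] E) : E →ₗ[ℂ] E).HasFiniteRange)
    (h1 : Module.finrank ℂ S.ker = 1) (n : ℕ) :
    {T | T ∈ fredholm E ∧ index T = -(n : ℤ)} = (fun B => B * R ^ n) '' unitAddFiniteRank E := by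
  ext T
  constructor
  · rintro ⟨hT, hTi⟩
    have hf : (T * S ^ n).IsFredholm := isFredholm_comp hT (isFredholm_pow hS n)
    refine ⟨T * S ^ n, mem_unitAddFiniteRank_iff.2 ⟨hf, ?_⟩, ?_⟩
    · rw [index_mul_pow hSR hS h1 hT, hTi, neg_add_cancel]
    · simp only [mul_assoc, pow_mul_pow_eq_one hSR, mul_one]
  · rintro ⟨B, hB, rfl⟩
    have hf : (B * R ^ n).IsFredholm := isFredholm_comp (isFredholm_of_mem hB) (isFredholm_pow hR n)
    refine ⟨hf, ?_⟩
    have h2 := index_mul_pow hSR hS h1 hf n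
    rw [mul_assoc, index_eq_zero_of_mem (mul_mem_unitAddFiniteRank_right hB
      (hasFiniteRange_pow_mul_pow_sub_one hRS n))] at h2
    linarith

theorem setOf_index_eq (hSR : S * R = 1) (hR : R.IsFredholm) (hS : S.IsFredholm)
    (hRS : ((R * S - 1 : E →L[ℂ] E) : E →ₗ[ℂ] E).HasFiniteRange)
    (h1 : Module.finrank ℂ (E ⧸ R.range) = 1) (n : ℕ) :
    {T | T ∈ fredholm E ∧ index T = n} = (fun B => S ^ n * B) '' unitAddFiniteRank E := by
  ext T
  constructor
  · rintro ⟨hT, hTi⟩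
    have hf : (R ^ n * T).IsFredholm := isFredholm_comp (isFredholm_pow hR n) hT
    refine ⟨R ^ n * T, mem_unitAddFiniteRank_iff.2 ⟨hf, ?_⟩, ?_⟩
    · rw [index_pow_mul hSR hR h1 hT, hTi, sub_self]
    · simp only [← mul_assoc, pow_mul_pow_eq_one hSR, one_mul]
  · rintro ⟨B, hB, rfl⟩
    have hf : (S ^ n * B).IsFredholm := isFredholm_comp (isFredholm_pow hS n) (isFredholm_of_mem hB)
    refine ⟨hf, ?_⟩
    have h2 := index_pow_mul hSR hR h1 hf n
    rw [← mul_assoc, index_eq_zero_of_mem (mul_mem_unitAddFiniteRank_left hB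
      (hasFiniteRange_pow_mul_pow_sub_one hRS n))] at h2
    linarith

variable (E) in
theorem exists_fredholm_index_eq [TopologicalSpace.SeparableSpace E]
    (hE : ¬ FiniteDimensional ℂ E) (k : ℤ) : ∃ T ∈ fredholm E, index T = k := by
  obtain ⟨R, S, hSR, hSk, hRk, hR, hS, hRS⟩ := exists_shift E hE
  obtain ⟨n, rfl | rfl⟩ := k.eq_nat_or_neg
  · exact ⟨_, (setOf_index_eq hSR hR hS hRS hRk n).ge ⟨1, one_mem_unitAddFiniteRank, rfl⟩⟩
  · exact ⟨_, (setOf_index_eq_neg hSR hR hS hRS hSk n).ge ⟨1, one_mem_unitAddFiniteRank, rfl⟩⟩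

variable (E) in
theorem isPreconnected_setOf_index_eq [TopologicalSpace.SeparableSpace E]
    (hE : ¬ FiniteDimensional ℂ E) (k : ℤ) :
    IsPreconnected {T | T ∈ fredholm E ∧ index T = k} := by
  obtain ⟨R, S, hSR, hSk, hRk, hR, hS, hRS⟩ := exists_shift E hE
  obtain ⟨n, rfl | rfl⟩ := k.eq_nat_or_neg
  · rw [setOf_index_eq hSR hR hS hRS hRk n]
    exact isPreconnected_unitAddFiniteRank.image _ (by fun_prop)
  · rw [setOf_index_eq_neg hSR hR hS hRS hSk n]
    exact isPreconnected_unitAddFiniteRank.image _ (by fun_prop)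

variable (E) in
/-- The index is locally constant on the set of Fredholm operators. -/
theorem continuousOn_index [TopologicalSpace.SeparableSpace E] (hE : ¬ FiniteDimensional ℂ E) :
    ContinuousOn (index : (E →L[ℂ] E) → ℤ) (fredholm E) := by
  obtain ⟨R, S, hSR, hSk, hRk, hR, hS, hRS⟩ := exists_shift E hE
  intro T hT
  refine tendsto_nhds_of_eventually_eq (f := index) ?_
  -- A shift power moves `T` into the open set of index 0; nearby Fredholm operators land there too,
  -- so they share the index of `T`.
  obtain ⟨n, hn | hn⟩ := (index T).eq_nat_or_neg
  · have hmem : R ^ n * T ∈ unitAddFiniteRank E := mem_unitAddFiniteRank_iff.2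
      ⟨isFredholm_comp (isFredholm_pow hR n) hT, by rw [index_pow_mul hSR hR hRk hT, hn, sub_self]⟩
    have hnhds : ∀ᶠ X in nhds T, R ^ n * X ∈ unitAddFiniteRank E :=
      (isOpen_unitAddFiniteRank.preimage (continuous_const_mul (R ^ n))).mem_nhds hmem
    filter_upwards [self_mem_nhdsWithin, nhdsWithin_le_nhds hnhds] with X hX hXm
    have := index_pow_mul hSR hR hRk hX n
    rw [index_eq_zero_of_mem hXm] at this
    linarith
  · have hmem : T * S ^ n ∈ unitAddFiniteRank E := mem_unitAddFiniteRank_iff.2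
      ⟨isFredholm_comp hT (isFredholm_pow hS n), by
        rw [index_mul_pow hSR hS hSk hT, hn, neg_add_cancel]⟩
    have hnhds : ∀ᶠ X in nhds T, X * S ^ n ∈ unitAddFiniteRank E :=
      (isOpen_unitAddFiniteRank.preimage (continuous_mul_const (S ^ n))).mem_nhds hmem
    filter_upwards [self_mem_nhdsWithin, nhdsWithin_le_nhds hnhds] with X hX hXm
    have := index_mul_pow hSR hS hSk hX n
    rw [index_eq_zero_of_mem hXm] at this
    linarith

variable (E) in
theorem connectedComponentIn_fredholm [TopologicalSpace.SeparableSpace E]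
    (hE : ¬ FiniteDimensional ℂ E) {T : E →L[ℂ] E} (hT : T ∈ fredholm E) :
    connectedComponentIn (fredholm E) T = {S | S ∈ fredholm E ∧ index S = index T} := by
  refine Set.Subset.antisymm (fun S hS => ?_) ?_
  · have hsub := connectedComponentIn_subset (fredholm E) T
    exact ⟨hsub hS, isPreconnected_connectedComponentIn.constant
      ((continuousOn_index E hE).mono hsub) hS (mem_connectedComponentIn hT)⟩
  · exact (isPreconnected_setOf_index_eq E hE (index T)).subset_connectedComponentIn ⟨hT, rfl⟩
      fun S hS => hS.1

end Components

/-! ### Smoothness through a linear surjection with no chosen complement. -/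

section Calculus

universe u

/-- The derivative of a map that factors through a surjection `Q` and an embedding `j` factors
accordingly. -/
theorem exists_hasFDerivAt_of_comp {X E F F' : Type*}
    [NormedAddCommGroup X] [NormedSpace ℝ X] [CompleteSpace X]
    [NormedAddCommGroup E] [NormedSpace ℝ E] [CompleteSpace E]
    [NormedAddCommGroup F] [NormedSpace ℝ F] [CompleteSpace F]
    [NormedAddCommGroup F'] [NormedSpace ℝ F']
    (Q : X →L[ℝ] E) (hQ : Function.Surjective Q) (j : F →L[ℝ] F') {C : NNReal}
    (hj : AntilipschitzWith C j) {g : E → F} {x : X} {D : X →L[ℝ] F'}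
    (hD : HasFDerivAt (fun y => j (g (Q y))) D x) :
    ∃ A : E →L[ℝ] F, HasFDerivAt g A (Q x) ∧ j ∘L A ∘L Q = D := by
  obtain ⟨M, hM, hlift⟩ := Q.exists_preimage_norm_le hQ
  have hjinj : Function.Injective j := hj.injective
  have hjcl : IsClosed (Set.range j) := hj.isClosed_range j.uniformContinuous
  have hline : ∀ v, HasDerivAt (fun t : ℝ => j (g (Q (x + t • v)))) (D v) 0 := by
    intro v
    have h1 : HasDerivAt (fun t : ℝ => x + t • v) v 0 := by
      simpa using ((hasDerivAt_id (0 : ℝ)).smul_const v).const_add x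
    have h2 : HasFDerivAt (fun y => j (g (Q y))) D (x + (0 : ℝ) • v) := by simpa using hD
    exact h2.comp_hasDerivAt (0 : ℝ) h1
  -- Difference quotients lie in the range of `j`, which is closed, so their limits do too.
  have hmem : ∀ v, ∃ w, j w = D v := by
    intro v
    have hlim := hasDerivAt_iff_tendsto_slope.1 (hline v)
    refine hjcl.mem_of_tendsto hlim (Filter.Eventually.of_forall fun t => ?_)
    exact ⟨(t - 0)⁻¹ • (g (Q (x + t • v)) - g (Q (x + (0 : ℝ) • v))), by
      simp [slope_def_module]⟩
  choose B hB using hmem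
  -- The map is constant along directions in `ker Q`, so `D` descends to the quotient.
  have hker : ∀ v, Q v = 0 → D v = 0 := by
    intro v hv
    have hconst : (fun t : ℝ => j (g (Q (x + t • v)))) = fun _ => j (g (Q x)) := by
      funext t
      simp [hv]
    exact (hconst ▸ hline v).unique (hasDerivAt_const _ _)
  choose σ hσ hσn using hlift
  have hDσ : ∀ v, D (σ (Q v)) = D v := by
    intro v
    have := hker (σ (Q v) - v) (by simp [hσ])
    rwa [map_sub, sub_eq_zero] at this
  have hBσ : ∀ y v, Q v = y → j (B (σ y)) = D v := by
    rintro _ v rfl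
    rw [hB, hDσ]
  let A₀ : E →ₗ[ℝ] F :=
    { toFun := fun y => B (σ y)
      map_add' := by
        intro y z
        apply hjinj
        rw [map_add, hB (σ y), hB (σ z), ← map_add, hBσ (y + z) (σ y + σ z) (by simp [hσ])]
      map_smul' := by
        intro c y
        apply hjinj
        rw [RingHom.id_apply, map_smul, hB (σ y), ← map_smul, hBσ (c • y) (c • σ y) (by simp [hσ])] }
  let A : E →L[ℝ] F := A₀.mkContinuous (C * (‖D‖ * M)) (by
    intro y
    calc ‖B (σ y)‖ ≤ C * ‖j (B (σ y))‖ := ZeroHomClass.bound_of_antilipschitz j hj _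
      _ = C * ‖D (σ y)‖ := by rw [hB]
      _ ≤ C * (‖D‖ * (M * ‖y‖)) := by
        gcongr
        exact (D.le_opNorm _).trans (by gcongr; exact hσn y)
      _ = C * (‖D‖ * M) * ‖y‖ := by ring)
  have hA : j ∘L A ∘L Q = D := by
    ext v
    exact hBσ (Q v) v rfl
  refine ⟨A, ?_, hA⟩
  rw [hasFDerivAt_iff_isLittleO_nhds_zero, Asymptotics.isLittleO_iff] at hD ⊢
  intro c hc
  -- Increments `k` are lifted to `σ k` of norm at most `M ‖k‖`, and `j` loses a factor `C`; `C + 1`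
  -- guards against `C = 0`.
  have hc' : 0 < c / ((C + 1) * M) := by positivity
  obtain ⟨δ, hδ, hball⟩ := Metric.eventually_nhds_iff.1 (hD hc')
  refine Metric.eventually_nhds_iff.2 ⟨δ / M, by positivity, fun k hk => ?_⟩
  rw [dist_zero_right] at hk
  have hkσ : ‖σ k‖ < δ := by
    refine (hσn k).trans_lt ?_
    rwa [lt_div_iff₀' hM] at hk
  have h1 := hball (y := σ k) (by rwa [dist_zero_right])
  have h2 : j (g (Q (x + σ k))) - j (g (Q x)) - D (σ k) = j (g (Q x + k) - g (Q x) - A k) := by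
    rw [← hA]
    simp [hσ]
  rw [h2] at h1
  have h3 : ‖g (Q x + k) - g (Q x) - A k‖ ≤ C * ‖j (g (Q x + k) - g (Q x) - A k)‖ :=
    ZeroHomClass.bound_of_antilipschitz j hj _
  calc ‖g (Q x + k) - g (Q x) - A k‖ ≤ C * (c / ((C + 1) * M) * (M * ‖k‖)) := by
        refine h3.trans ?_
        gcongr
        refine h1.trans ?_
        gcongr
        exact hσn k
    _ = C / (C + 1) * (c * ‖k‖) := by field_simp
    _ ≤ 1 * (c * ‖k‖) := by
        gcongr
        rw [div_le_one (by positivity)]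
        linarith
    _ = c * ‖k‖ := one_mul _

/-- A map `g` is `C^n` if its composition with a surjective linear map on the right and a linear
embedding on the left is. -/
theorem contDiffOn_image_of_comp_nat {X E : Type u}
    [NormedAddCommGroup X] [NormedSpace ℝ X] [CompleteSpace X]
    [NormedAddCommGroup E] [NormedSpace ℝ E] [CompleteSpace E]
    (Q : X →L[ℝ] E) (hQ : Function.Surjective Q) {V : Set X} (hV : IsOpen V) (n : ℕ) :
    ∀ {F F' : Type u} [NormedAddCommGroup F] [NormedSpace ℝ F] [CompleteSpace F]
      [NormedAddCommGroup F'] [NormedSpace ℝ F'] (j : F →L[ℝ] F') {C : NNReal}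
      (_ : AntilipschitzWith C j) {g : E → F}
      (_ : ContDiffOn ℝ n (fun x => j (g (Q x))) V), ContDiffOn ℝ n g (Q '' V) := by
  have hopen : IsOpenMap Q := Q.isOpenMap hQ
  induction n with
  | zero =>
    intro F F' _ _ _ _ _ j C hj g hg
    simp only [Nat.cast_zero, contDiffOn_zero] at hg ⊢
    have hcont : ContinuousOn (fun x => g (Q x)) V :=
      (hj.isUniformEmbedding j.uniformContinuous).isEmbedding.continuousOn_iff.2 hg
    rintro _ ⟨x, hx, rfl⟩
    refine ContinuousAt.continuousWithinAt fun W hW => ?_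
    have h1 := (hcont.continuousAt (hV.mem_nhds hx)) hW
    exact Filter.mem_map.2 (Filter.mem_of_superset (hopen.image_mem_nhds h1)
      (Set.image_subset_iff.2 fun y hy => hy))
  | succ n ih =>
    intro F F' _ _ _ _ _ j C hj g hg
    obtain ⟨M, hM, hlift⟩ := Q.exists_preimage_norm_le hQ
    push_cast at hg ⊢
    rw [contDiffOn_succ_iff_fderiv_of_isOpen hV] at hg
    rw [contDiffOn_succ_iff_fderiv_of_isOpen (hopen V hV)]
    obtain ⟨hdiff, -, hfd⟩ := hg
    have key : ∀ x ∈ V, ∃ A : E →L[ℝ] F, HasFDerivAt g A (Q x) ∧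
        j ∘L A ∘L Q = fderiv ℝ (fun x => j (g (Q x))) x := fun x hx =>
      exists_hasFDerivAt_of_comp Q hQ j hj (hdiff.hasFDerivAt (hV.mem_nhds hx))
    refine ⟨?_, by simp, ?_⟩
    · rintro _ ⟨x, hx, rfl⟩
      obtain ⟨A, hA, -⟩ := key x hx
      exact hA.differentiableAt.differentiableWithinAt
    · let J : (E →L[ℝ] F) →L[ℝ] (X →L[ℝ] F') :=
        (ContinuousLinearMap.compL ℝ X F F' j) ∘L ((ContinuousLinearMap.compL ℝ X E F).flip Q)
      have hJ : AntilipschitzWith (C * M.toNNReal) J := by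
        refine J.antilipschitz_of_bound fun A => ?_
        rw [NNReal.coe_mul, Real.coe_toNNReal M hM.le]
        refine A.opNorm_le_bound (by positivity) fun y => ?_
        obtain ⟨x, rfl, hx⟩ := hlift y
        calc ‖A (Q x)‖ ≤ C * ‖J A x‖ := ZeroHomClass.bound_of_antilipschitz j hj _
          _ ≤ C * (‖J A‖ * (M * ‖Q x‖)) := by
            gcongr
            exact ((J A).le_opNorm _).trans (by gcongr)
          _ = C * M * ‖J A‖ * ‖Q x‖ := by ring
      refine ih J hJ (hfd.congr fun x hx => ?_)
      obtain ⟨A, hA, hAQ⟩ := key x hx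
      rw [hA.fderiv, ← hAQ]
      rfl

theorem contDiffOn_image_of_comp {X E F : Type u}
    [NormedAddCommGroup X] [NormedSpace ℝ X] [CompleteSpace X]
    [NormedAddCommGroup E] [NormedSpace ℝ E] [CompleteSpace E]
    [NormedAddCommGroup F] [NormedSpace ℝ F] [CompleteSpace F]
    (Q : X →L[ℝ] E) (hQ : Function.Surjective Q) {V : Set X} (hV : IsOpen V) {g : E → F}
    (hg : ContDiffOn ℝ ∞ (g ∘ Q) V) : ContDiffOn ℝ ∞ g (Q '' V) := by
  rw [contDiffOn_infty] at hg ⊢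
  exact fun n => contDiffOn_image_of_comp_nat Q hQ hV n (ContinuousLinearMap.id ℝ F)
    AntilipschitzWith.id (hg n)

/-- A strict derivative which is surjective at a point near which the map is injective is itself
injective. -/
theorem injective_of_hasStrictFDerivAt {E F : Type*}
    [NormedAddCommGroup E] [NormedSpace ℝ E] [CompleteSpace E]
    [NormedAddCommGroup F] [NormedSpace ℝ F] [CompleteSpace F]
    {f : E → F} {f' : E →L[ℝ] F} {x : E} (hf : HasStrictFDerivAt f f' x)
    (hsurj : Function.Surjective f') {U : Set E} (hU : U ∈ nhds x) (hinj : Set.InjOn f U) :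
    Function.Injective f' := by
  refine (injective_iff_map_eq_zero f').2 fun v hv => ?_
  by_contra hv0
  have hrange : f'.range = ⊤ := LinearMap.range_eq_top.2 hsurj
  set R := f'.nonlinearRightInverseOfSurjective hrange
  have hRpos : 0 < R.nnnorm := f'.nonlinearRightInverseOfSurjective_nnnorm_pos hrange
  set c : NNReal := R.nnnorm⁻¹ / 4 with hc
  have hcpos : 0 < c := by positivity
  obtain ⟨s, hs, happ⟩ := hf.approximates_deriv_on_nhds (Or.inr hcpos)
  obtain ⟨r, hr, hball⟩ := Metric.mem_nhds_iff.1 (Filter.inter_mem hs hU)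
  obtain ⟨w, hw0, hwr, hw⟩ : ∃ w : E, 0 < ‖w‖ ∧ 2 * ‖w‖ < r ∧ f' w = 0 := by
    have hvpos : 0 < ‖v‖ := norm_pos_iff.2 hv0
    have hn : ‖(r / (4 * ‖v‖)) • v‖ = r / 4 := by
      rw [norm_smul, Real.norm_of_nonneg (by positivity)]
      field_simp
    exact ⟨(r / (4 * ‖v‖)) • v, by rw [hn]; positivity, by rw [hn]; linarith, by rw [map_smul, hv, smul_zero]⟩
  have hsub : Metric.closedBall (x + w) (‖w‖ / 2) ⊆ Metric.ball x r := by
    intro y hy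
    rw [Metric.mem_closedBall] at hy
    have h1 : dist (x + w) x = ‖w‖ := by simp [dist_eq_norm]
    have := dist_triangle y (x + w) x
    rw [Metric.mem_ball]
    linarith
  have hon := happ.surjOn_closedBall_of_nonlinearRightInverse R (by positivity)
    (hsub.trans (hball.trans Set.inter_subset_left))
  have hxs : x ∈ s := (hball (Metric.mem_ball_self hr)).1
  have hws : x + w ∈ s := (hball (hsub (Metric.mem_closedBall_self (by positivity)))).1
  have hdist : f x ∈ Metric.closedBall (f (x + w)) (((R.nnnorm : ℝ)⁻¹ - c) * (‖w‖ / 2)) := by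
    have h1 := happ x hxs (x + w) hws
    rw [sub_add_cancel_left, map_neg, hw, neg_zero, sub_zero, norm_neg] at h1
    rw [Metric.mem_closedBall, dist_eq_norm]
    refine h1.trans ?_
    rw [hc]
    push_cast
    have : 0 < (R.nnnorm : ℝ)⁻¹ := by positivity
    nlinarith
  obtain ⟨y, hy, hfy⟩ := hon hdist
  have hyx : y = x := hinj (hball (hsub hy)).2 (hball (Metric.mem_ball_self hr)).2 hfy
  rw [hyx, Metric.mem_closedBall, dist_eq_norm, sub_add_cancel_left, norm_neg] at hy
  linarith

/-- A homeomorphism which becomes smooth with surjective derivatives after composition with a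
surjective linear map is a diffeomorphism. -/
theorem contDiffOn_and_symm_of_comp {X E F : Type u}
    [NormedAddCommGroup X] [NormedSpace ℝ X] [CompleteSpace X]
    [NormedAddCommGroup E] [NormedSpace ℝ E] [CompleteSpace E]
    [NormedAddCommGroup F] [NormedSpace ℝ F] [CompleteSpace F]
    (Q : X →L[ℝ] E) (hQ : Function.Surjective Q) {V : Set X} (hV : IsOpen V)
    (P : OpenPartialHomeomorph E F) (hP : Q '' V = P.source)
    (hsmooth : ContDiffOn ℝ ∞ (P ∘ Q) V)
    (hsurj : ∀ x ∈ V, Function.Surjective (fderiv ℝ (P ∘ Q) x)) :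
    ContDiffOn ℝ ∞ P P.source ∧ ContDiffOn ℝ ∞ P.symm P.target := by
  have h1 : ContDiffOn ℝ ∞ P P.source := hP ▸ contDiffOn_image_of_comp Q hQ hV hsmooth
  refine ⟨h1, fun a ha => ContDiffAt.contDiffWithinAt ?_⟩
  have hat : ContDiffAt ℝ ∞ P (P.symm a) :=
    h1.contDiffAt (P.open_source.mem_nhds (P.map_target ha))
  have hstrict := hat.hasStrictFDerivAt (by simp)
  obtain ⟨x, hx, hxa⟩ : P.symm a ∈ Q '' V := hP ▸ P.map_target ha
  have hs : Function.Surjective (fderiv ℝ P (P.symm a)) := by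
    have h2 : HasFDerivAt (P ∘ Q) (fderiv ℝ P (P.symm a) ∘L Q) x :=
      (hxa ▸ hstrict.hasFDerivAt : HasFDerivAt P (fderiv ℝ P (P.symm a)) (Q x)).comp x Q.hasFDerivAt
    have h3 := hsurj x hx
    rw [h2.fderiv] at h3
    exact Function.Surjective.of_comp h3
  have hi := injective_of_hasStrictFDerivAt hstrict hs
    (P.open_source.mem_nhds (P.map_target ha)) P.injOn
  exact P.contDiffAt_symm (f₀' := ContinuousLinearEquiv.ofBijective (fderiv ℝ P (P.symm a))
    (LinearMap.ker_eq_bot.2 hi) (LinearMap.range_eq_top.2 hs)) ha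
    (by rw [ContinuousLinearEquiv.coe_ofBijective]; exact hstrict.hasFDerivAt) hat

end Calculus

section Calkin

variable (H : Type*) [NormedAddCommGroup H] [InnerProductSpace ℂ H] [CompleteSpace H]

theorem Q_surjective : Function.Surjective (Q H) := Ideal.Quotient.mk_surjective

/-- The quotient map `𝓑(H) → 𝓑(H)/𝒦(H)` as a continuous real-linear map. -/
def QL : (H →L[ℂ] H) →L[ℝ] Calkin H :=
  LinearMap.mkContinuous
    { toFun := Q H
      map_add' := map_add (Q H)
      map_smul' := fun c T => by
        have h1 : (c • T : H →L[ℂ] H) = (c : ℂ) • T := by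
          ext x
          simp
        have h2 : ∀ z : ℂ, Q H (z • T) = z • Q H T := fun z => rfl
        rw [h1, h2]
        rfl } 1 fun T => by
      rw [one_mul]
      exact Q_norm_le H T

theorem QL_apply (T : H →L[ℂ] H) : QL H T = Q H T := rfl

theorem QL_surjective : Function.Surjective (QL H) := Q_surjective H

theorem continuous_Q : Continuous (Q H) := (QL H).continuous

theorem isOpenMap_Q : IsOpenMap (Q H) := (QL H).isOpenMap (QL_surjective H)

theorem iota_injective : Function.Injective (iota H) := by
  refine (injective_iff_map_eq_one _).2 fun x hx => ?_
  obtain ⟨a, rfl⟩ := QuotientGroup.mk_surjective x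
  rw [QuotientGroup.eq_one_iff, mem_K_iff]
  exact congrArg Units.val hx

theorem isOpenEmbedding_coe_iota :
    Topology.IsOpenEmbedding (fun x : G H ⧸ K H => (iota H x : Calkin H)) := by
  refine Topology.IsOpenEmbedding.of_continuous_injective_isOpenMap ?_ ?_ ?_
  · refine isQuotientMap_quotient_mk'.continuous_iff.2 ?_
    exact (continuous_Q H).comp Units.continuous_val
  · exact fun x y hxy => iota_injective H (Units.ext hxy)
  · intro U hU
    have : (fun x : G H ⧸ K H => (iota H x : Calkin H)) '' U =
        Q H '' (Units.val '' ((QuotientGroup.mk : G H → G H ⧸ K H) ⁻¹' U)) := by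
      ext y
      constructor
      · rintro ⟨x, hx, rfl⟩
        obtain ⟨a, rfl⟩ := QuotientGroup.mk_surjective x
        exact ⟨_, ⟨a, hx, rfl⟩, rfl⟩
      · rintro ⟨_, ⟨a, ha, rfl⟩, rfl⟩
        exact ⟨_, ha, rfl⟩
    rw [this]
    exact isOpenMap_Q H _ (Units.isOpenEmbedding_val.isOpenMap _
      (hU.preimage QuotientGroup.continuous_mk))

theorem range_iota : (iota H).range = identityComponent H := by
  have hopen : IsOpen ((iota H).range : Set (Calkin H)ˣ) := by
    have : ((iota H).range : Set (Calkin H)ˣ) =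
        Units.val ⁻¹' Set.range (fun x : G H ⧸ K H => (iota H x : Calkin H)) := by
      ext u
      exact ⟨fun ⟨x, hx⟩ => ⟨x, congrArg Units.val hx⟩, fun ⟨x, hx⟩ => ⟨x, Units.ext hx⟩⟩
    rw [this]
    exact (isOpenEmbedding_coe_iota H).isOpen_range.preimage Units.continuous_val
  have hconn : IsPreconnected ((iota H).range : Set (Calkin H)ˣ) := by
    rw [← (Units.isOpenEmbedding_val (R := Calkin H)).isInducing.isPreconnected_image]
    have : (Units.val '' ((iota H).range : Set (Calkin H)ˣ)) =
        Set.range (fun a : G H => Q H (a : H →L[ℂ] H)) := by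
      ext y
      constructor
      · rintro ⟨_, ⟨x, rfl⟩, rfl⟩
        obtain ⟨a, rfl⟩ := QuotientGroup.mk_surjective x
        exact ⟨a, rfl⟩
      · rintro ⟨a, rfl⟩
        exact ⟨_, ⟨QuotientGroup.mk a, rfl⟩, rfl⟩
    rw [this]
    have := connectedSpace_units H
    exact isPreconnected_range ((continuous_Q H).comp Units.continuous_val)
  apply le_antisymm
  · exact hconn.subset_connectedComponent (one_mem (iota H).range)
  · exact IsClopen.connectedComponent_subset ⟨Subgroup.isClosed_of_isOpen _ hopen, hopen⟩
      (one_mem (iota H).range)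

/-- The isomorphism from `G/K` onto the identity component of the invertibles of the Calkin
algebra. -/
def iotaEquiv : (G H ⧸ K H) ≃* identityComponent H :=
  (MonoidHom.ofInjective (iota_injective H)).trans (MulEquiv.subgroupCongr (range_iota H))

theorem coe_iotaEquiv (x : G H ⧸ K H) : (iotaEquiv H x : (Calkin H)ˣ) = iota H x := rfl

theorem exists_mem_identityComponent_iff {T : H →L[ℂ] H} :
    (∃ u ∈ identityComponent H, (u : Calkin H) = Q H T) ↔ T ∈ fredholm H ∧ index T = 0 := by
  have hmem : T ∈ fredholm H ∧ index T = 0 ↔ T ∈ unitAddFiniteRank H :=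
    mem_unitAddFiniteRank_iff.symm
  rw [hmem, ← range_iota]
  constructor
  · rintro ⟨_, ⟨x, rfl⟩, hx⟩
    obtain ⟨a, rfl⟩ := QuotientGroup.mk_surjective x
    exact mem_unitAddFiniteRank_of_isCompactOperator a ((Q_eq_iff H _ _).1 hx.symm)
  · rintro ⟨a, ha⟩
    exact ⟨iota H (QuotientGroup.mk a), ⟨_, rfl⟩,
      ((Q_eq_iff H _ _).2 (isCompactOperator_of_hasFiniteRange ha)).symm⟩

theorem isUnit_Q_of_isFredholm {T : H →L[ℂ] H} (hT : T.IsFredholm) : IsUnit (Q H T) := by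
  obtain ⟨S, hST, hTS⟩ := hT.exists_isQuasiInverse
  have h1 : Q H (S * T) = Q H 1 := (Q_eq_iff H _ _).2
    (isCompactOperator_of_hasFiniteRange
      (LinearMap.FiniteRangeSetoid.equiv_iff_hasFiniteRange.1 hST.equiv))
  have h2 : Q H (T * S) = Q H 1 := (Q_eq_iff H _ _).2
    (isCompactOperator_of_hasFiniteRange
      (LinearMap.FiniteRangeSetoid.equiv_iff_hasFiniteRange.1 hTS.equiv))
  rw [map_mul, map_one] at h1 h2
  exact isUnit_iff_exists.2 ⟨_, h2, h1⟩

theorem not_surjective_iota [TopologicalSpace.SeparableSpace H] (hH : ¬ FiniteDimensional ℂ H) :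
    ¬ Function.Surjective (iota H) := by
  intro hs
  obtain ⟨T, hT, hTi⟩ := exists_fredholm_index_eq H hH 1
  obtain ⟨u, hu⟩ := isUnit_Q_of_isFredholm H hT
  obtain ⟨x, hx⟩ := hs u
  have := (exists_mem_identityComponent_iff H).1 ⟨u, range_iota H ▸ ⟨x, hx⟩, hu⟩
  omega

end Calkin

section Manifold

variable (H : Type*) [NormedAddCommGroup H] [InnerProductSpace ℂ H] [CompleteSpace H]

theorem exists_isQuotientBanachLieGroup :
    ∃ _ : ChartedSpace (Calkin H) (G H ⧸ K H), IsQuotientBanachLieGroup H := by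
  have hj := isOpenEmbedding_coe_iota H
  let : ChartedSpace (Calkin H) (G H ⧸ K H) := hj.singletonChartedSpace
  have hman : IsManifold 𝓘(ℝ, Calkin H) ∞ (G H ⧸ K H) := hj.isManifold_singleton
  have hman1 : IsManifold 𝓘(ℝ, Calkin H) 1 (G H ⧸ K H) := hj.isManifold_singleton
  have hv : ContMDiff 𝓘(ℝ, Calkin H) 𝓘(ℝ, Calkin H) ∞
      (fun x : G H ⧸ K H => (iota H x : Calkin H)) := contMDiff_isOpenEmbedding hj
  have hmk : ContMDiff 𝓘(ℝ, H →L[ℂ] H) 𝓘(ℝ, Calkin H) ∞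
      (QuotientGroup.mk : G H → G H ⧸ K H) := by
    apply ContMDiff.of_comp_isOpenEmbedding hj
    exact (QL H).contMDiff.comp (Units.contMDiff_val (𝕜 := ℝ))
  refine ⟨inferInstance, ⟨?_, hmk, ?_⟩⟩
  · refine { toIsManifold := hman, contMDiff_mul := ?_, contMDiff_inv := ?_ }
    · apply ContMDiff.of_comp_isOpenEmbedding hj
      have h : ContMDiff (𝓘(ℝ, Calkin H).prod 𝓘(ℝ, Calkin H)) 𝓘(ℝ, Calkin H × Calkin H) ∞
          (fun x : (G H ⧸ K H) × (G H ⧸ K H) =>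
            ((iota H x.1 : Calkin H), (iota H x.2 : Calkin H))) :=
        (hv.comp contMDiff_fst).prodMk_space (hv.comp contMDiff_snd)
      have h2 := (contMDiff_iff_contDiff.2 (contDiff_mul (𝕜 := ℝ) (𝔸 := Calkin H))).comp h
      refine h2.congr fun x => ?_
      simp
    · apply ContMDiff.of_comp_isOpenEmbedding hj
      have h : (fun x : G H ⧸ K H => (iota H x : Calkin H)) ∘ (fun x : G H ⧸ K H => x⁻¹) =
          Ring.inverse ∘ (fun x : G H ⧸ K H => (iota H x : Calkin H)) := by
        funext x
        simp
      rw [h]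
      intro x
      refine ContMDiffAt.comp x ?_ (hv x)
      rw [contMDiffAt_iff_contDiffAt]
      exact contDiffAt_ringInverse ℝ (iota H x)
  · intro g w
    set j : G H ⧸ K H → Calkin H := fun x => (iota H x : Calkin H)
    have hjd : MDifferentiableAt 𝓘(ℝ, Calkin H) 𝓘(ℝ, Calkin H) j (QuotientGroup.mk g) :=
      (hv _).mdifferentiableAt (by simp)
    have hmkd : MDifferentiableAt 𝓘(ℝ, H →L[ℂ] H) 𝓘(ℝ, Calkin H)
        (QuotientGroup.mk : G H → G H ⧸ K H) g := (hmk g).mdifferentiableAt (by simp)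
    have hvald : MDifferentiableAt 𝓘(ℝ, H →L[ℂ] H) 𝓘(ℝ, H →L[ℂ] H)
        (Units.val : G H → H →L[ℂ] H) g :=
      (Units.contMDiff_val (𝕜 := ℝ) (n := ∞) g).mdifferentiableAt (by simp)
    have hinj : Function.Injective (mfderiv 𝓘(ℝ, Calkin H) 𝓘(ℝ, Calkin H) j
        (QuotientGroup.mk g)) :=
      (mdifferentiable_chart (I := 𝓘(ℝ, Calkin H))
        (QuotientGroup.mk g : G H ⧸ K H)).mfderiv_injective (mem_chart_source _ _)
    have hsurj : Function.Surjective (mfderiv 𝓘(ℝ, H →L[ℂ] H) 𝓘(ℝ, H →L[ℂ] H)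
        (Units.val : G H → H →L[ℂ] H) g) :=
      (mdifferentiable_chart (I := 𝓘(ℝ, H →L[ℂ] H)) g).mfderiv_surjective (mem_chart_source _ _)
    obtain ⟨T, hT⟩ := QL_surjective H (mfderiv 𝓘(ℝ, Calkin H) 𝓘(ℝ, Calkin H) j
        (QuotientGroup.mk g) w)
    obtain ⟨v, hv'⟩ := hsurj T
    refine ⟨v, hinj ?_⟩
    have h1 := mfderiv_comp g hjd hmkd
    have h2 := mfderiv_comp g (QL H).mdifferentiableAt hvald
    have h3 : j ∘ (QuotientGroup.mk : G H → G H ⧸ K H) = QL H ∘ Units.val := rfl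
    rw [h3, h2] at h1
    have h4 := congrArg (fun L => L v) h1
    refine Eq.trans h4.symm ?_
    rw [← hT, ← hv', ContinuousLinearMap.mfderiv_eq]
    rfl

theorem exists_openPartialHomeomorph [ChartedSpace (Calkin H) (G H ⧸ K H)]
    (h : IsQuotientBanachLieGroup H) (x : G H ⧸ K H) :
    ∃ P : OpenPartialHomeomorph (Calkin H) (Calkin H),
      (P.source = (fun y => (iota H y : Calkin H)) '' (chartAt (Calkin H) x).source) ∧
      (P.target = (chartAt (Calkin H) x).target) ∧
      (∀ y ∈ (chartAt (Calkin H) x).source, P (iota H y : Calkin H) = chartAt (Calkin H) x y) ∧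
      ContDiffOn ℝ ∞ P P.source ∧ ContDiffOn ℝ ∞ P.symm P.target := by
  have := h.lieGroup
  have hman : IsManifold 𝓘(ℝ, Calkin H) ∞ (G H ⧸ K H) := h.lieGroup.toIsManifold
  have hman1 : IsManifold 𝓘(ℝ, Calkin H) 1 (G H ⧸ K H) := .of_le (n := ∞) (by simp)
  set e := chartAt (Calkin H) x
  have hj := isOpenEmbedding_coe_iota H
  let j := hj.toOpenPartialHomeomorph
  have hjc : ∀ y, j y = (iota H y : Calkin H) := fun y => rfl
  let P := j.symm.trans e
  have hjs : j.source = Set.univ := rfl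
  have hsymm : ∀ y, j.symm (iota H y : Calkin H) = y := fun y => j.left_inv (by rw [hjs]; trivial)
  have hsource : P.source = (fun y => (iota H y : Calkin H)) '' e.source := by
    ext z
    constructor
    · rintro ⟨hz1, hz2⟩
      exact ⟨j.symm z, hz2, j.right_inv hz1⟩
    · rintro ⟨y, hy, rfl⟩
      exact ⟨j.map_source (by rw [hjs]; trivial), by
        rw [Set.mem_preimage]
        exact (hsymm y).symm ▸ hy⟩
  have htarget : P.target = e.target := by
    simp [P, hjs]
  have hP : ∀ y, P (iota H y : Calkin H) = e y := fun y => congrArg e (hsymm y)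
  set V : Set (H →L[ℂ] H) := Units.val '' ((QuotientGroup.mk : G H → G H ⧸ K H) ⁻¹' e.source)
  have hVo : IsOpen V := Units.isOpenEmbedding_val.isOpenMap _
    (e.open_source.preimage QuotientGroup.continuous_mk)
  have hQV : QL H '' V = P.source := by
    rw [hsource]
    ext z
    constructor
    · rintro ⟨_, ⟨g, hg, rfl⟩, rfl⟩
      exact ⟨QuotientGroup.mk g, hg, rfl⟩
    · rintro ⟨y, hy, rfl⟩
      obtain ⟨g, rfl⟩ := QuotientGroup.mk_surjective y
      exact ⟨_, ⟨g, hy, rfl⟩, rfl⟩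
  have key : ∀ T ∈ V, ContDiffAt ℝ ∞ (P ∘ QL H) T ∧
      Function.Surjective (fderiv ℝ (P ∘ QL H) T) := by
    rintro _ ⟨g, hg, rfl⟩
    set u := chartAt (H →L[ℂ] H) g with hu
    have hug : u g = (g : H →L[ℂ] H) := rfl
    have hug' : u.symm (g : H →L[ℂ] H) = g := u.left_inv (mem_chart_source _ g)
    have hgt : (g : H →L[ℂ] H) ∈ u.target := mem_chart_target _ g
    have heq : P ∘ QL H =ᶠ[nhds (g : H →L[ℂ] H)]
        e ∘ (QuotientGroup.mk : G H → G H ⧸ K H) ∘ u.symm := by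
      filter_upwards [u.open_target.mem_nhds hgt] with T hT
      have hTu : (u.symm T : H →L[ℂ] H) = T := u.right_inv hT
      have : QL H T = (iota H (QuotientGroup.mk (u.symm T)) : Calkin H) := by
        rw [coe_iota_mk, hTu, QL_apply]
      simp only [Function.comp_apply, this, hP]
    have hus : ContMDiffAt 𝓘(ℝ, H →L[ℂ] H) 𝓘(ℝ, H →L[ℂ] H) ∞ u.symm (g : H →L[ℂ] H) :=
      (contMDiffOn_chart_symm (I := 𝓘(ℝ, H →L[ℂ] H)) (x := g)).contMDiffAt
        (u.open_target.mem_nhds hgt)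
    have hmk : ContMDiffAt 𝓘(ℝ, H →L[ℂ] H) 𝓘(ℝ, Calkin H) ∞
        (QuotientGroup.mk : G H → G H ⧸ K H) (u.symm (g : H →L[ℂ] H)) := h.contMDiff_mk _
    have he : ContMDiffAt 𝓘(ℝ, Calkin H) 𝓘(ℝ, Calkin H) ∞ e
        (QuotientGroup.mk (u.symm (g : H →L[ℂ] H)) : G H ⧸ K H) := by
      rw [hug']
      exact (contMDiffOn_chart (I := 𝓘(ℝ, Calkin H)) (x := x)).contMDiffAt
        (e.open_source.mem_nhds hg)
    have hmku := hmk.comp (g : H →L[ℂ] H) hus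
    have htot := ContMDiffAt.comp (g : H →L[ℂ] H) he hmku
    refine ⟨htot.contDiffAt.congr_of_eventuallyEq heq, ?_⟩
    rw [heq.fderiv_eq, ← mfderiv_eq_fderiv,
      mfderiv_comp (g : H →L[ℂ] H) (he.mdifferentiableAt (by simp))
        (hmku.mdifferentiableAt (by simp)),
      mfderiv_comp (g : H →L[ℂ] H) (hmk.mdifferentiableAt (by simp))
        (hus.mdifferentiableAt (by simp))]
    have h1 : Function.Surjective (mfderiv 𝓘(ℝ, H →L[ℂ] H) 𝓘(ℝ, H →L[ℂ] H) u.symm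
        (g : H →L[ℂ] H)) :=
      (mdifferentiable_chart (I := 𝓘(ℝ, H →L[ℂ] H)) g).symm.mfderiv_surjective hgt
    have h2 := h.surjective_mfderiv_mk (u.symm (g : H →L[ℂ] H))
    have h3 : Function.Surjective (mfderiv 𝓘(ℝ, Calkin H) 𝓘(ℝ, Calkin H) e
        (QuotientGroup.mk (u.symm (g : H →L[ℂ] H)) : G H ⧸ K H)) := by
      refine (mdifferentiable_chart (I := 𝓘(ℝ, Calkin H)) x).mfderiv_surjective ?_
      rw [hug']
      exact hg
    exact h3.comp (h2.comp h1)
  obtain ⟨h1, h2⟩ := contDiffOn_and_symm_of_comp (QL H) (QL_surjective H) hVo P hQV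
    (fun T hT => (key T hT).1.contDiffWithinAt) (fun T hT => (key T hT).2)
  exact ⟨P, hsource, htarget, fun y _ => hP y, h1, h2⟩

theorem contMDiff_iotaEquiv [ChartedSpace (Calkin H) (G H ⧸ K H)]
    (h : IsQuotientBanachLieGroup H) :
    ContMDiff 𝓘(ℝ, Calkin H) 𝓘(ℝ, Calkin H) ∞ (iotaEquiv H) := by
  have hman : IsManifold 𝓘(ℝ, Calkin H) ∞ (G H ⧸ K H) := h.lieGroup.toIsManifold
  apply ContMDiff.of_comp_isOpenEmbedding (isOpenEmbedding_coe H)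
  intro x
  obtain ⟨P, hs, ht, hP, -, hPs⟩ := exists_openPartialHomeomorph H h x
  set e := chartAt (Calkin H) x
  have hx : x ∈ e.source := mem_chart_source _ x
  have hPx : ContMDiffAt 𝓘(ℝ, Calkin H) 𝓘(ℝ, Calkin H) ∞ P.symm (e x) :=
    (hPs.contDiffAt (P.open_target.mem_nhds (ht ▸ e.map_source hx))).contMDiffAt
  have he : ContMDiffAt 𝓘(ℝ, Calkin H) 𝓘(ℝ, Calkin H) ∞ e x :=
    (contMDiffOn_chart (I := 𝓘(ℝ, Calkin H)) (x := x)).contMDiffAt (e.open_source.mem_nhds hx)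
  refine (hPx.comp x he).congr_of_eventuallyEq ?_
  filter_upwards [e.open_source.mem_nhds hx] with y hy
  rw [Function.comp_apply, Function.comp_apply, ← hP y hy]
  exact (P.left_inv (hs ▸ ⟨y, hy, rfl⟩)).symm

theorem contMDiff_iotaEquiv_symm [ChartedSpace (Calkin H) (G H ⧸ K H)]
    (h : IsQuotientBanachLieGroup H) :
    ContMDiff 𝓘(ℝ, Calkin H) 𝓘(ℝ, Calkin H) ∞ (iotaEquiv H).symm := by
  have hman : IsManifold 𝓘(ℝ, Calkin H) ∞ (G H ⧸ K H) := h.lieGroup.toIsManifold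
  intro u
  set x := (iotaEquiv H).symm u
  obtain ⟨P, hs, ht, hP, hPc, -⟩ := exists_openPartialHomeomorph H h x
  set e := chartAt (Calkin H) x
  have hx : x ∈ e.source := mem_chart_source _ x
  have hval : ∀ w : identityComponent H, ((w : (Calkin H)ˣ) : Calkin H) =
      (iota H ((iotaEquiv H).symm w) : Calkin H) := fun w => by
    rw [← coe_iotaEquiv, MulEquiv.apply_symm_apply]
  have hus : ((u : (Calkin H)ˣ) : Calkin H) ∈ P.source := hs ▸ ⟨x, hx, (hval u).symm⟩
  have hv : ContMDiff 𝓘(ℝ, Calkin H) 𝓘(ℝ, Calkin H) ∞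
      (fun w : identityComponent H => ((w : (Calkin H)ˣ) : Calkin H)) :=
    contMDiff_isOpenEmbedding (isOpenEmbedding_coe H)
  have hPu : ContMDiffAt 𝓘(ℝ, Calkin H) 𝓘(ℝ, Calkin H) ∞ P ((u : (Calkin H)ˣ) : Calkin H) :=
    (hPc.contDiffAt (P.open_source.mem_nhds hus)).contMDiffAt
  have hPuv : P ((u : (Calkin H)ˣ) : Calkin H) = e x := by rw [hval u, hP _ hx]
  have he : ContMDiffAt 𝓘(ℝ, Calkin H) 𝓘(ℝ, Calkin H) ∞ e.symm
      (P ((u : (Calkin H)ˣ) : Calkin H)) := by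
    rw [hPuv]
    exact (contMDiffOn_chart_symm (I := 𝓘(ℝ, Calkin H)) (x := x)).contMDiffAt
      (e.open_target.mem_nhds (e.map_source hx))
  have hcomp := ContMDiffAt.comp u he (hPu.comp u (hv u))
  refine hcomp.congr_of_eventuallyEq ?_
  filter_upwards [(P.open_source.preimage hv.continuous).mem_nhds hus] with w hw
  rw [Set.mem_preimage, hs] at hw
  obtain ⟨y, hy, hyw⟩ := hw
  have hyw' : y = (iotaEquiv H).symm w := iota_injective H (Units.ext (hyw.trans (hval w)))
  subst hyw'
  rw [Function.comp_apply, Function.comp_apply, hval w]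
  exact ((congrArg e.symm (hP _ hy)).trans (e.left_inv hy)).symm

end Manifold

end CalkinRemark

end

theorem mainTheorem4 (H : Type*) [NormedAddCommGroup H] [InnerProductSpace ℂ H] [CompleteSpace H]
    [TopologicalSpace.SeparableSpace H] (hH : ¬ FiniteDimensional ℂ H) :
    -- `𝓑(H)ˣ` is connected
    ConnectedSpace (CalkinRemark.G H) ∧
    -- the connected components of `𝓕(H)` are exactly the sets of operators of index `k`, `k ∈ ℤ`
    ((∀ k : ℤ, ∃ T ∈ CalkinRemark.fredholm H, CalkinRemark.index T = k) ∧
      ∀ T ∈ CalkinRemark.fredholm H, connectedComponentIn (CalkinRemark.fredholm H) T =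
        {S | S ∈ CalkinRemark.fredholm H ∧ CalkinRemark.index S = CalkinRemark.index T}) ∧
    -- the identity component of the invertibles of the Calkin algebra consists exactly of the
    -- classes of Fredholm operators of index `0`
    (∀ T : H →L[ℂ] H,
      (∃ u ∈ CalkinRemark.identityComponent H, (u : CalkinRemark.Calkin H) = CalkinRemark.Q H T) ↔
        T ∈ CalkinRemark.fredholm H ∧ CalkinRemark.index T = 0) ∧
    -- `G/K` is a Banach-Lie group with `G → G/K` a submersion
    (∃ _ : ChartedSpace (CalkinRemark.Calkin H) (CalkinRemark.G H ⧸ CalkinRemark.K H),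
      CalkinRemark.IsQuotientBanachLieGroup H) ∧
    -- for every such structure, `ι` is an isomorphism of Banach-Lie groups from `G/K` onto the
    -- identity component
    (∀ _ : ChartedSpace (CalkinRemark.Calkin H) (CalkinRemark.G H ⧸ CalkinRemark.K H),
      CalkinRemark.IsQuotientBanachLieGroup H →
      ∃ Φ : (CalkinRemark.G H ⧸ CalkinRemark.K H) ≃* CalkinRemark.identityComponent H,
        (∀ x, (Φ x : (CalkinRemark.Calkin H)ˣ) = CalkinRemark.iota H x) ∧
        ContMDiff 𝓘(ℝ, CalkinRemark.Calkin H) 𝓘(ℝ, CalkinRemark.Calkin H) ∞ Φ ∧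
        ContMDiff 𝓘(ℝ, CalkinRemark.Calkin H) 𝓘(ℝ, CalkinRemark.Calkin H) ∞ Φ.symm) ∧
    ¬ Function.Surjective (CalkinRemark.iota H) := by
  refine ⟨CalkinRemark.connectedSpace_units H,
    ⟨CalkinRemark.exists_fredholm_index_eq H hH,
      fun T hT => CalkinRemark.connectedComponentIn_fredholm H hH hT⟩,
    fun T => CalkinRemark.exists_mem_identityComponent_iff H,
    CalkinRemark.exists_isQuotientBanachLieGroup H, fun _ h => ?_,
    CalkinRemark.not_surjective_iota H hH⟩
  exact ⟨CalkinRemark.iotaEquiv H, CalkinRemark.coe_iotaEquiv H,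
    CalkinRemark.contMDiff_iotaEquiv H h, CalkinRemark.contMDiff_iotaEquiv_symm H h⟩
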